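/- **Setting.** Let $N\ge 2$, let $p_1,\dots,p_N\in\mathbb R^{N-1}$ satisfy $|p_i-p_j|=1$ for $i\ne j$, and put $F_i(x)=\frac12x+\frac12p_i$. Let $V_0=\{p_1,\dots,p_N\}$, $V_{m+1}=\bigcup_{i=1}^N F_i(V_m)$, and let $V=\overline{\bigcup_m V_m}$ be the Sierpinski gasket. For $x,y\in V_m$ write $x\sim_m y$ if $x$ and $y$ lie in a common cell $F_{w_1}\circ\dots\circ F_{w_m}(V)$ of level $m$. For $u\in C(V)$ let $$W_m(u)=\frac12\Big(\frac{N+2}{N}\Big)^m\sum_{x,y\in V_m,\;x\sim_m y}(u(x)-u(y))^2,\qquad W(u)=\lim_{m\to\infty}W_m(u)\in[0,\infty]$$ (the sum is over ordered pairs; the sequence is increasing in $m$), and let $H^1(V)=\{u\in C(V): W(u)<\infty\}$. Let $\mu$ be a finite Borel measure on $V$ such that every nonempty relatively open subset of $V$ has positive measure and $\mu(V_0)=0$. For $B=(B_1,\dots,B_N)$ with $B_i:\mathbb R\to[0,\infty]$ define $W_B:L^2_\mu(V)\to[0,\infty]$ by $W_B(u)=W(u)+\sum_{i=1}^NB_i(u(p_i))$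 if $u\in H^1(V)$ and $W_B(u)=\infty$ otherwise. $B$ is *normalised* if $B_i(0)=0$ for all $i$. The subgradient of $\tilde W:H\to[0,\infty]$ on a real Hilbert space $H$ at a point $u$ with $\tilde W(u)<\infty$ is $\partial\tilde W(u)=\{f\in H:\tilde W(u+v)-\tilde W(u)\ge\langle f,v\rangle\ \forall v\in H\}$ (and it is empty at the other points). The *semigroup generated by $\tilde W$* is the family $S=(S(t))_{t\ge0}$ on $\overline{\{\tilde W<\infty\}}$ for which $u(t)=S(t)u_0$ is the solution $u\in C([0,\infty);H)\cap H^1_{loc}((0,\infty);H)$ of $\dot u+\partial\tilde W(u)\ni0$ a.e. on $(0,\infty)$, $u(0)=u_0$. A family $S=(S(t))_{t\ge0}$ of maps on $L^2_\mu(V)$ is *positive* if $u\ge0$ implies $S(t)u\ge0$ for all $t\ge 0$; *order preserving* if $u\le v$ implies $S(t)u\le S(t)v$ for all $t\ge 0$; *$L^\infty$-contractive* if $\|S(t)u-S(t)v\|_{L^\infty}\le\|u-v\|_{L^\infty}$ (in $[0,\infty]$) for all $t\ge0$ and all $u,v\in L^2_\mu(V)$. $S_1$ is *dominated* by $S_2$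 if $S_2$ is order preserving and $|u|\le v$ implies $|S_1(t)u|\le S_2(t)v$ for all $t\ge0$; it is *totally dominated* by $S_2$ if it is dominated both by $S_2$ and by $-S_2(-\,\cdot\,)$. A function on $\mathbb R$ with values in $[-\infty,\infty]$ is *bi-monotone* if it is decreasing on $(-\infty,0]$ and increasing on $[0,\infty)$. **Theorem.** Let $B=(B_1,\dots,B_N)$ be normalised and assume that $W_B$ is convex and lower semicontinuous on $L^2_\mu(V)$. Then $\{W_B<\infty\}$ is dense in $L^2_\mu(V)$, and $W_B$ generates a unique semigroup $S_B$, which is therefore defined on all of $L^2_\mu(V)$. Moreover: 1. $S_B$ is positive and order preserving. 2. If every $B_i$ is convex, then $S_B$ is $L^\infty$-contractive. Let $\hat B=(\hat B_1,\dots,\hat B_N)$ be a second normalised tuple for which $W_{\hat B}$ is convex and lower semicontinuous, and let $S_{\hat B}$ be the semigroup generated by $W_{\hat B}$. With the convention $\infty-\infty=\infty$: 3. If $s\mapsto\hat B_i(s)-B_i(|s|)$ is bi-monotone for every $i$, then $S_{\hat B}$ is dominated by $S_B$. 4. If $s\mapsto\hat B_i(s)-B_i(|s|)$ and $s\mapsto\hat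 B_i(s)-B_i(-|s|)$ are bi-monotone for every $i$, then $S_{\hat B}$ is totally dominated by $S_B$. -/

import Mathlib

open MeasureTheory Filter Set
open scoped ENNReal NNReal

noncomputable section

namespace Gasket

/-! ### The Sierpinski gasket -/

/-- The space `ℝ^(N-1)` with the Euclidean norm. -/
abbrev Space (N : ℕ) : Type := EuclideanSpace ℝ (Fin (N - 1))

/-- The similarity `F_i x = x / 2 + p_i / 2`. -/
def simMap {N : ℕ} (p : Fin N → Space N) (i : Fin N) (x : Space N) : Space N :=
  (1 / 2 : ℝ) • x + (1 / 2 : ℝ) • p i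

/-- `F_w = F_{w_1} ∘ ⋯ ∘ F_{w_m}` for a word `w = (w_1, …, w_m)`. -/
def wordMap {N : ℕ} (p : Fin N → Space N) : List (Fin N) → Space N → Space N
  | [] => id
  | i :: w => simMap p i ∘ wordMap p w

/-- `V_0 = {p_1, …, p_N}` and `V_{m+1} = ⋃ i, F_i (V_m)`. -/
def vertexSet {N : ℕ} (p : Fin N → Space N) : ℕ → Set (Space N)
  | 0 => Set.range p
  | m + 1 => ⋃ i, simMap p i '' vertexSet p m

/-- The Sierpinski gasket `V`, the closure of `V_* = ⋃ m, V_m`. -/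
def gasket {N : ℕ} (p : Fin N → Space N) : Set (Space N) :=
  closure (⋃ m, vertexSet p m)

theorem vertexSet_finite {N : ℕ} (p : Fin N → Space N) (m : ℕ) : (vertexSet p m).Finite := by
  induction m with
  | zero => exact Set.finite_range p
  | succ m ih => exact Set.finite_iUnion fun i => ih.image _

theorem vertexSet_subset_gasket {N : ℕ} (p : Fin N → Space N) (m : ℕ) :
    vertexSet p m ⊆ gasket p :=
  (Set.subset_iUnion (vertexSet p) m).trans subset_closure

/-- The set `V_m`, as a finite set of points of `V`. -/
def vertices {N : ℕ} (p : Fin N → Space N) (m : ℕ) : Finset (gasket p) :=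
  ((vertexSet_finite p m).preimage
    (Subtype.val_injective (p := (· ∈ gasket p))).injOn).toFinset

theorem mem_vertices {N : ℕ} (p : Fin N → Space N) (m : ℕ) (x : gasket p) :
    x ∈ vertices p m ↔ (x : Space N) ∈ vertexSet p m := by
  simp [vertices]

/-- The boundary point `p_i`, as a point of `V`. -/
def bdry {N : ℕ} (p : Fin N → Space N) (i : Fin N) : gasket p :=
  ⟨p i, vertexSet_subset_gasket p 0 ⟨i, rfl⟩⟩

/-- `x` and `y` lie in a common cell `F_w(V)` of level `m`. -/
def SameCell {N : ℕ} (p : Fin N → Space N) (m : ℕ) (x y : gasket p) : Prop :=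
  ∃ w : List (Fin N), w.length = m ∧
    (x : Space N) ∈ wordMap p w '' gasket p ∧ (y : Space N) ∈ wordMap p w '' gasket p

/-! ### The energy -/

open Classical in
/-- The `m`-energy `W_m(u)`; the sum runs over ordered pairs of points of `V_m`. -/
def energyAt {N : ℕ} (p : Fin N → Space N) (m : ℕ) (u : gasket p → ℝ) : ℝ :=
  (1 / 2) * (((N : ℝ) + 2) / N) ^ m *
    ∑ x ∈ vertices p m, ∑ y ∈ vertices p m, if SameCell p m x y then (u x - u y) ^ 2 else 0

/-- The energy `W(u) = lim W_m(u) ∈ [0, ∞]`. The sequence `W_m(u)` is increasing, so that the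
limit exists and is the lower limit. -/
def energy {N : ℕ} (p : Fin N → Space N) (u : gasket p → ℝ) : ℝ≥0∞ :=
  liminf (fun m => ENNReal.ofReal (energyAt p m u)) atTop

/-- The space `H^1(V)` of continuous functions of finite energy. -/
def sobolev {N : ℕ} (p : Fin N → Space N) : Set C(gasket p, ℝ) :=
  {u | energy p u < ∞}

/-- The perturbed energy `W_B` on `L²_μ(V)`. When `μ` charges every nonempty open set, an element
of `L²_μ(V)` has at most one continuous representative, so that the infimum below is over at most
one function; over the empty set it is `∞`. -/
def perturbedEnergy {N : ℕ} (p : Fin N → Space N) (μ : Measure (gasket p))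
    (B : Fin N → ℝ → ℝ≥0∞) (f : Lp ℝ 2 μ) : ℝ≥0∞ :=
  ⨅ (u : C(gasket p, ℝ)) (_ : u ∈ sobolev p ∧ (u : gasket p → ℝ) =ᵐ[μ] f),
    energy p u + ∑ i, B i (u (bdry p i))

end Gasket

/-! ### Convex energies on Hilbert spaces and the semigroups they generate -/

/-- Convexity of a function with values in `[0, ∞]`. -/
def ConvexEnergy {E : Type*} [AddCommGroup E] [Module ℝ E] (W : E → ℝ≥0∞) : Prop :=
  ∀ u v : E, ∀ a b : ℝ, 0 ≤ a → 0 ≤ b → a + b = 1 →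
    W (a • u + b • v) ≤ ENNReal.ofReal a * W u + ENNReal.ofReal b * W v

/-- The effective domain `{W < ∞}`. -/
def effDomain {E : Type*} (W : E → ℝ≥0∞) : Set E := {u | W u < ∞}

/-- The subgradient of `W` at `u`; it is empty outside the effective domain. -/
def subgradient {H : Type*} [NormedAddCommGroup H] [InnerProductSpace ℝ H]
    (W : H → ℝ≥0∞) (u : H) : Set H :=
  {f | u ∈ effDomain W ∧
    ∀ v : H, (W u : EReal) + ((inner ℝ f v : ℝ) : EReal) ≤ (W (u + v) : EReal)}

/-- `u ∈ C([0,∞); H) ∩ H^1_loc((0,∞); H)` solves `u' + ∂W(u) ∋ 0` almost everywhere on `(0,∞)`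
and `u(0) = u₀`. Here `g` is the weak derivative of `u`: a continuous function is in
`H^1_loc((0,∞); H)` with weak derivative `g` iff `g` is locally square integrable on `(0,∞)` and
`u` is a primitive of `g`. -/
def IsGradientFlow {H : Type*} [NormedAddCommGroup H] [InnerProductSpace ℝ H]
    (W : H → ℝ≥0∞) (u₀ : H) (u : ℝ≥0 → H) : Prop :=
  Continuous u ∧ u 0 = u₀ ∧
    ∃ g : ℝ → H,
      (∀ a b : ℝ, 0 < a → a < b → MemLp g 2 (volume.restrict (Set.Icc a b))) ∧
      (∀ a b : ℝ≥0, 0 < a → a < b → u b - u a = ∫ t in (a : ℝ)..(b : ℝ), g t) ∧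
      ∀ᵐ t ∂(volume.restrict (Set.Ioi (0 : ℝ))), -g t ∈ subgradient W (u t.toNNReal)

/-- `S` is the semigroup generated by `W` on the closure of the effective domain of `W`:
`t ↦ S(t)u₀` is the solution of the Cauchy problem with initial value `u₀`. -/
def IsGeneratedBy {H : Type*} [NormedAddCommGroup H] [InnerProductSpace ℝ H]
    (W : H → ℝ≥0∞) (S : ℝ≥0 → H → H) : Prop :=
  ∀ u₀ ∈ closure (effDomain W), IsGradientFlow W u₀ (fun t => S t u₀)

/-! ### Qualitative properties of semigroups on `L²` -/

section Properties

variable {X : Type*} [MeasurableSpace X] {μ : Measure X}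

/-- Positivity. -/
def IsPositiveSG (S : ℝ≥0 → Lp ℝ 2 μ → Lp ℝ 2 μ) : Prop :=
  ∀ (t : ℝ≥0) (u : Lp ℝ 2 μ), 0 ≤ u → 0 ≤ S t u

/-- Order preservation. -/
def IsOrderPreserving (S : ℝ≥0 → Lp ℝ 2 μ → Lp ℝ 2 μ) : Prop :=
  ∀ (t : ℝ≥0) (u v : Lp ℝ 2 μ), u ≤ v → S t u ≤ S t v

/-- `L^∞`-contractivity; the norms may be infinite. -/
def IsLinftyContractive (S : ℝ≥0 → Lp ℝ 2 μ → Lp ℝ 2 μ) : Prop :=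
  ∀ (t : ℝ≥0) (u v : Lp ℝ 2 μ),
    eLpNorm (S t u - S t v : Lp ℝ 2 μ) ∞ μ ≤ eLpNorm (u - v : Lp ℝ 2 μ) ∞ μ

/-- `S₁` is dominated by `S₂`. -/
def IsDominatedBy (S₁ S₂ : ℝ≥0 → Lp ℝ 2 μ → Lp ℝ 2 μ) : Prop :=
  IsOrderPreserving S₂ ∧
    ∀ (t : ℝ≥0) (u v : Lp ℝ 2 μ), |u| ≤ v → |S₁ t u| ≤ S₂ t v

/-- `S₁` is totally dominated by `S₂`. -/
def IsTotallyDominatedBy (S₁ S₂ : ℝ≥0 → Lp ℝ 2 μ → Lp ℝ 2 μ) : Prop :=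
  IsDominatedBy S₁ S₂ ∧ IsDominatedBy S₁ (fun t u => -S₂ t (-u))

end Properties

/-! ### Bi-monotone functions -/

/-- Decreasing on `(-∞, 0]` and increasing on `[0, ∞)`. -/
def IsBimonotone (D : ℝ → EReal) : Prop :=
  AntitoneOn D (Set.Iic 0) ∧ MonotoneOn D (Set.Ici 0)

open Classical in
/-- The difference `a - b` of elements of `[0, ∞]`, with `∞ - ∞ = ∞`. -/
def extSub (a b : ℝ≥0∞) : EReal :=
  if a = ∞ then ⊤ else (a : EReal) - (b : EReal)

end

open scoped Topology

noncomputable section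

namespace ConvexFlow

/-! ### Subgradients and resolvents of convex functions on a Hilbert space -/

/-! Existence is convex analysis in a Hilbert space `H`. The resolvent `(1 + l ∂W)⁻¹` exists because
the functional `W + ‖· - x‖² / (2l)` has a minimiser, and it is nonexpansive because `∂W` is
monotone. Iterating it is the implicit Euler scheme. A Crandall–Liggett estimate
(`norm_iterate_sub_iterate_sq_le`) makes the scheme converge, and two discrete inequalities survive
the limit: an evolution variational inequality and a speed bound away from time zero. The limit is
thus locally Lipschitz on `(0, ∞)`, hence differentiable almost everywhere in a Hilbert space, and
differentiating the variational inequality gives `-u' ∈ ∂W(u)`.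

Everything else, uniqueness included, follows from one comparison principle,
`sub_le_of_isGradientFlow`. Let `u` and `v` be flows of `W₁` and `W₂`, and `w = (u - v - k)⁺`. If
`W₁(u - w) + W₂(v + w) ≤ W₁(u) + W₂(v)`, then adding the two subgradient inequalities gives `⟨w, u'
- v'⟩ ≤ 0`, so `‖(u - v - k)⁺‖²` is nonincreasing. For perturbed energies, the part on the gasket
always satisfies this inequality, by a pointwise quadratic inequality (`truncation_sq_le`). What
remains is a condition on the numbers `u(p_i)` and `v(p_i)`. For `k = 0` truncation replaces `(u,
v)` by `(min, max)`, so the condition is trivial when `B₁ = B₂`. For `k ≥ 0` it holds when `B₁ = B₂`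
is convex. For domination with `v ≥ 0` it is bi-monotonicity, one half giving `u ≤ v` and the other
`-u ≤ v`.

Density of the domain uses the geometry of the gasket. Since `μ(V₀) = 0`, continuous functions
vanishing on `V₀` suffice. They are approximated uniformly by piecewise harmonic functions with the
same boundary values, at which the boundary terms are `B_i(0) = 0`. Harmonic functions arise by
iterating the explicit extension `harmonicExt`, which shrinks oscillations by `N / (N + 2)` and
leaves the renormalised energy unchanged. -/

theorem le_of_tendsto_of_lsc {E : Type*} [TopologicalSpace E] {W : E → ℝ≥0∞}
    (hl : LowerSemicontinuous W) {x : ℕ → E} {y : E} {c : ℕ → ℝ} {d : ℝ}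
    (hx : Tendsto x atTop (𝓝 y)) (hc : Tendsto c atTop (𝓝 d))
    (h : ∀ᶠ n in atTop, W (x n) < ∞ ∧ (W (x n)).toReal ≤ c n) : W y < ∞ ∧ (W y).toReal ≤ d := by
  have key : W y ≤ ENNReal.ofReal d := by
    by_contra! hlt
    obtain ⟨r, hr1, hr2⟩ := exists_between hlt
    have e1 := hx.eventually (hl y r hr2)
    have e2 := ((ENNReal.continuous_ofReal.tendsto d).comp hc).eventually (gt_mem_nhds hr1)
    obtain ⟨n, h1, h2, h3⟩ := (e1.and (e2.and h)).exists
    have h4 : W (x n) ≤ ENNReal.ofReal (c n) := by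
      rw [← ENNReal.ofReal_toReal h3.1.ne]
      exact ENNReal.ofReal_le_ofReal h3.2
    exact absurd (h1.trans_le h4) (not_lt.2 h2.le)
  have hd : 0 ≤ d := by
    refine ge_of_tendsto hc (h.mono fun n hn => ENNReal.toReal_nonneg.trans hn.2)
  refine ⟨key.trans_lt ENNReal.ofReal_lt_top, ?_⟩
  have := ENNReal.toReal_mono ENNReal.ofReal_ne_top key
  rwa [ENNReal.toReal_ofReal hd] at this

variable {H : Type*} [NormedAddCommGroup H] [InnerProductSpace ℝ H] {W : H → ℝ≥0∞}

/-- The real-valued form used throughout. As `toReal` sends `∞` to `0`, finiteness is carried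
separately. -/
theorem mem_subgradient_iff {u f : H} :
    f ∈ subgradient W u ↔ W u < ∞ ∧
      ∀ v, W v < ∞ → (W u).toReal + inner ℝ f (v - u) ≤ (W v).toReal := by
  have key : ∀ v : H, W u < ∞ → W v < ∞ →
      ((W u : EReal) + ((inner ℝ f (v - u) : ℝ) : EReal) ≤ (W v : EReal) ↔
        (W u).toReal + inner ℝ f (v - u) ≤ (W v).toReal) := by
    intro v hu hv
    conv_lhs => rw [← ENNReal.ofReal_toReal hu.ne, ← ENNReal.ofReal_toReal hv.ne]
    rw [EReal.coe_ennreal_ofReal, EReal.coe_ennreal_ofReal, max_eq_left ENNReal.toReal_nonneg,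
      max_eq_left ENNReal.toReal_nonneg, ← EReal.coe_add, EReal.coe_le_coe_iff]
  constructor
  · rintro ⟨hu, h⟩
    refine ⟨hu, fun v hv => (key v hu hv).1 ?_⟩
    have := h (v - u)
    rwa [add_sub_cancel] at this
  · rintro ⟨hu, h⟩
    refine ⟨hu, fun v => ?_⟩
    rcases lt_or_ge (W (u + v)) ∞ with hv | hv
    · have := (key (u + v) hu hv).2 (h _ hv)
      rwa [add_sub_cancel_left] at this
    · rw [top_le_iff.1 hv]
      exact le_top

theorem subgradient_monotone {u v f g : H} (hf : f ∈ subgradient W u)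
    (hg : g ∈ subgradient W v) : 0 ≤ inner ℝ (f - g) (u - v) := by
  rw [mem_subgradient_iff] at hf hg
  have h1 := hf.2 v hg.1
  have h2 := hg.2 u hf.1
  have h3 : inner ℝ f (v - u) = -inner ℝ f (u - v) := by rw [← inner_neg_right, neg_sub]
  rw [inner_sub_left]
  linarith

/-- The resolvent relation `y = (1 + l ∂W)⁻¹ x`. -/
def IsProx (W : H → ℝ≥0∞) (l : ℝ) (x y : H) : Prop := l⁻¹ • (x - y) ∈ subgradient W y

/-- Monotonicity of the subgradient reads `‖y - y'‖² ≤ ⟨x - x', y - y'⟩`; Cauchy–Schwarz finishes.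
-/
theorem IsProx.norm_sub_le {l : ℝ} (hl : 0 < l) {x y x' y' : H} (h : IsProx W l x y)
    (h' : IsProx W l x' y') : ‖y - y'‖ ≤ ‖x - x'‖ := by
  have h0 := subgradient_monotone h h'
  rw [← smul_sub, inner_smul_left] at h0
  have h1 : 0 ≤ inner ℝ ((x - y) - (x' - y')) (y - y') := by
    simp only [conj_trivial] at h0
    exact nonneg_of_mul_nonneg_right h0 (inv_pos.2 hl)
  have h2 : (x - y) - (x' - y') = (x - x') - (y - y') := by abel
  rw [h2, inner_sub_left, real_inner_self_eq_norm_sq] at h1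
  have h3 := real_inner_le_norm (x - x') (y - y')
  by_contra! hc
  nlinarith [norm_nonneg (x - x'), norm_nonneg (y - y')]

theorem convex_toReal (hc : ConvexEnergy W) {u v : H} (hu : W u < ∞) (hv : W v < ∞) {a b : ℝ}
    (ha : 0 ≤ a) (hb : 0 ≤ b) (hab : a + b = 1) :
    W (a • u + b • v) < ∞ ∧
      (W (a • u + b • v)).toReal ≤ a * (W u).toReal + b * (W v).toReal := by
  have h := hc u v a b ha hb hab
  have h1 : ENNReal.ofReal a * W u < ∞ := ENNReal.mul_lt_top ENNReal.ofReal_lt_top hu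
  have h2 : ENNReal.ofReal b * W v < ∞ := ENNReal.mul_lt_top ENNReal.ofReal_lt_top hv
  refine ⟨h.trans_lt (ENNReal.add_lt_top.2 ⟨h1, h2⟩), ?_⟩
  have h3 := ENNReal.toReal_mono (ENNReal.add_lt_top.2 ⟨h1, h2⟩).ne h
  rwa [ENNReal.toReal_add h1.ne h2.ne, ENNReal.toReal_mul, ENNReal.toReal_mul,
    ENNReal.toReal_ofReal ha, ENNReal.toReal_ofReal hb] at h3

theorem norm_midpoint_sub_sq (a b x : H) :
    ‖(1 / 2 : ℝ) • a + (1 / 2 : ℝ) • b - x‖ ^ 2 =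
      1 / 2 * ‖a - x‖ ^ 2 + 1 / 2 * ‖b - x‖ ^ 2 - 1 / 4 * ‖a - b‖ ^ 2 := by
  have h1 : (1 / 2 : ℝ) • a + (1 / 2 : ℝ) • b - x = (1 / 2 : ℝ) • ((a - x) + (b - x)) := by
    module
  have h2 : a - b = (a - x) - (b - x) := by abel
  rw [h1, h2, norm_smul, mul_pow, norm_add_sq_real (a - x), norm_sub_sq_real (a - x) (b - x),
    Real.norm_of_nonneg (by norm_num)]
  ring

/-- The strictly convex functional that defines the resolvent has a minimiser. -/
theorem exists_minimizer [CompleteSpace H] (hc : ConvexEnergy W) (hl : LowerSemicontinuous W)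
    (hne : ∃ v, W v < ∞) {l : ℝ} (hpos : 0 < l) (x : H) :
    ∃ y, W y < ∞ ∧ ∀ v, W v < ∞ →
      (W y).toReal + (2 * l)⁻¹ * ‖y - x‖ ^ 2 ≤ (W v).toReal + (2 * l)⁻¹ * ‖v - x‖ ^ 2 := by
  set Φ : H → ℝ := fun v => (W v).toReal + (2 * l)⁻¹ * ‖v - x‖ ^ 2 with hΦ
  have hlinv : 0 < (2 * l)⁻¹ := by positivity
  set A : Set ℝ := Φ '' {v | W v < ∞} with hA
  have hAne : A.Nonempty := by
    obtain ⟨v, hv⟩ := hne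
    exact ⟨_, v, hv, rfl⟩
  have hAbdd : BddBelow A := by
    refine ⟨0, ?_⟩
    rintro _ ⟨v, -, rfl⟩
    have : 0 ≤ (W v).toReal := ENNReal.toReal_nonneg
    positivity
  have hge : ∀ v, W v < ∞ → sInf A ≤ Φ v := fun v hv => csInf_le hAbdd ⟨v, hv, rfl⟩
  have hseq : ∀ n : ℕ, ∃ v, W v < ∞ ∧ Φ v ≤ sInf A + 1 / ((n : ℝ) + 1) := by
    intro n
    obtain ⟨_, ⟨v, hv, rfl⟩, h⟩ := Real.lt_sInf_add_pos hAne (Nat.one_div_pos_of_nat (n := n))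
    exact ⟨v, hv, h.le⟩
  choose s hs1 hs2 using hseq
  have hdist : ∀ N m k : ℕ, N ≤ m → N ≤ k →
      dist (s m) (s k) ≤ Real.sqrt (8 * l * (1 / ((N : ℝ) + 1))) := by
    intro N m k hm hk
    rw [dist_eq_norm]
    apply Real.le_sqrt_of_sq_le
    -- Midpoint argument: the quadratic term gains `‖s m - s k‖² / (8l)` at the midpoint, whose
    -- value cannot drop below the infimum. Hence the minimising sequence is Cauchy.
    have h1 := convex_toReal hc (hs1 m) (hs1 k) (a := 1 / 2) (b := 1 / 2)
      (by norm_num) (by norm_num) (by norm_num)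
    have h2 := hge _ h1.1
    have h3 := norm_midpoint_sub_sq (s m) (s k) x
    have h4 := hs2 m
    have h5 := hs2 k
    have h6 : 1 / ((m : ℝ) + 1) ≤ 1 / ((N : ℝ) + 1) := Nat.one_div_le_one_div hm
    have h7 : 1 / ((k : ℝ) + 1) ≤ 1 / ((N : ℝ) + 1) := Nat.one_div_le_one_div hk
    simp only [hΦ] at h2 h4 h5
    rw [h3] at h2
    have h8 : (2 * l)⁻¹ * (1 / 4 * ‖s m - s k‖ ^ 2) ≤ 1 / ((N : ℝ) + 1) := by
      nlinarith [h1.2]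
    have h9 : (2 * l)⁻¹ * (1 / 4 * ‖s m - s k‖ ^ 2) = ‖s m - s k‖ ^ 2 / (8 * l) := by
      field_simp; ring
    rw [h9, div_le_iff₀ (by positivity)] at h8
    linarith
  have hlim0 : Tendsto (fun N : ℕ => 1 / ((N : ℝ) + 1)) atTop (𝓝 0) :=
    tendsto_one_div_add_atTop_nhds_zero_nat
  have hcau : CauchySeq s := by
    refine cauchySeq_of_le_tendsto_0 _ (fun n m N hn hm => hdist N n m hn hm) ?_
    have := (Real.continuous_sqrt.tendsto _).comp (hlim0.const_mul (8 * l))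
    simpa using! this
  obtain ⟨y, hy⟩ := cauchySeq_tendsto_of_complete hcau
  -- Only `W` is merely lower semicontinuous; the quadratic term is continuous and is moved into the
  -- bound.
  have hfin := le_of_tendsto_of_lsc hl hy
    (c := fun n => sInf A + 1 / ((n : ℝ) + 1) - (2 * l)⁻¹ * ‖s n - x‖ ^ 2)
    (d := sInf A + 0 - (2 * l)⁻¹ * ‖y - x‖ ^ 2)
    ((hlim0.const_add _).sub ((((hy.sub_const x).norm).pow 2).const_mul _))
    (Eventually.of_forall fun n => ⟨hs1 n, by have := hs2 n; simp only [hΦ] at this; linarith⟩)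
  refine ⟨y, hfin.1, fun v hv => ?_⟩
  have := hge v hv
  simp only [hΦ] at this
  linarith [hfin.2]

/-- First-order optimality: compare the minimiser `y` with `y + s(v - y)`, use convexity, divide by
`s` and let `s → 0`. -/
theorem exists_isProx [CompleteSpace H] (hc : ConvexEnergy W) (hl : LowerSemicontinuous W)
    (hne : ∃ v, W v < ∞) {l : ℝ} (hpos : 0 < l) (x : H) : ∃ y, IsProx W l x y := by
  obtain ⟨y, hy, hmin⟩ := exists_minimizer hc hl hne hpos x
  refine ⟨y, mem_subgradient_iff.2 ⟨hy, fun v hv => ?_⟩⟩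
  have key : ∀ s : ℝ, 0 < s → s ≤ 1 →
      (W y).toReal - (W v).toReal ≤ l⁻¹ * inner ℝ (y - x) (v - y)
        + s * ((2 * l)⁻¹ * ‖v - y‖ ^ 2) := by
    intro s hs0 hs1
    have h1 := convex_toReal hc hy hv (a := 1 - s) (b := s) (by linarith) hs0.le (by ring)
    have h2 := hmin _ h1.1
    have h3 : (1 - s) • y + s • v - x = (y - x) + s • (v - y) := by module
    rw [h3, norm_add_sq_real, norm_smul, inner_smul_right, Real.norm_of_nonneg hs0.le] at h2
    have h4 : s * ((W y).toReal - (W v).toReal) ≤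
        s * (l⁻¹ * inner ℝ (y - x) (v - y) + s * ((2 * l)⁻¹ * ‖v - y‖ ^ 2)) := by
      have e : (2 * l)⁻¹ * (2 * (s * inner ℝ (y - x) (v - y))) =
          s * (l⁻¹ * inner ℝ (y - x) (v - y)) := by field_simp
      nlinarith [h1.2]
    exact le_of_mul_le_mul_left h4 hs0
  have hlim : Tendsto (fun n : ℕ => l⁻¹ * inner ℝ (y - x) (v - y)
      + (1 / ((n : ℝ) + 1)) * ((2 * l)⁻¹ * ‖v - y‖ ^ 2)) atTop
      (𝓝 (l⁻¹ * inner ℝ (y - x) (v - y) + 0 * ((2 * l)⁻¹ * ‖v - y‖ ^ 2))) :=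
    (tendsto_one_div_add_atTop_nhds_zero_nat.mul_const _).const_add _
  have h5 := ge_of_tendsto' hlim fun n => key (1 / ((n : ℝ) + 1)) (by positivity)
    (by rw [div_le_one (by positivity)]; linarith [n.cast_nonneg (α := ℝ)])
  have h6 : inner ℝ (l⁻¹ • (x - y)) (v - y) = -(l⁻¹ * inner ℝ (y - x) (v - y)) := by
    rw [inner_smul_left, ← neg_sub y x, inner_neg_left]
    simp
  rw [h6]
  linarith

open Classical in
/-- The resolvent `(1 + l ∂W)⁻¹`, where it exists. -/
def prox (W : H → ℝ≥0∞) (l : ℝ) (x : H) : H :=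
  if h : ∃ y, IsProx W l x y then h.choose else x

theorem isProx_prox [CompleteSpace H] (hc : ConvexEnergy W) (hl : LowerSemicontinuous W)
    (hne : ∃ v, W v < ∞) {l : ℝ} (hpos : 0 < l) (x : H) : IsProx W l x (prox W l x) := by
  have h := exists_isProx hc hl hne hpos x
  rw [prox, dif_pos h]
  exact h.choose_spec

/-! ### The implicit Euler scheme -/

section Euler

variable {H : Type*} [NormedAddCommGroup H] [InnerProductSpace ℝ H] {W : H → ℝ≥0∞}
  {J : ℝ → H → H}

theorem norm_iterate_sub_le (hJ : ∀ l, 0 < l → ∀ x, IsProx W l x (J l x)) {l : ℝ} (hl : 0 < l)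
    (k : ℕ) (x y : H) : ‖(J l)^[k] x - (J l)^[k] y‖ ≤ ‖x - y‖ := by
  induction k with
  | zero => simp
  | succ k ih =>
    rw [Function.iterate_succ_apply', Function.iterate_succ_apply']
    exact ((hJ l hl _).norm_sub_le hl (hJ l hl _)).trans ih

/-- The point `x` is itself the resolvent of `x + l f`, so nonexpansiveness applies. -/
theorem norm_sub_prox_le (hJ : ∀ l, 0 < l → ∀ x, IsProx W l x (J l x)) {l : ℝ} (hl : 0 < l)
    {x f : H} (hf : f ∈ subgradient W x) : ‖J l x - x‖ ≤ l * ‖f‖ := by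
  have h : IsProx W l (x + l • f) x := by
    rw [IsProx, add_sub_cancel_left, smul_smul, inv_mul_cancel₀ hl.ne', one_smul]
    exact hf
  have := (hJ l hl x).norm_sub_le hl h
  rwa [← norm_neg, neg_sub, sub_add_cancel_left, norm_neg, norm_smul, Real.norm_of_nonneg hl.le,
    norm_sub_rev] at this

theorem norm_step_le (hJ : ∀ l, 0 < l → ∀ x, IsProx W l x (J l x)) {l : ℝ} (hl : 0 < l)
    (x : H) {i j : ℕ} (hij : i ≤ j) :
    ‖(J l)^[j + 1] x - (J l)^[j] x‖ ≤ ‖(J l)^[i + 1] x - (J l)^[i] x‖ := by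
  obtain ⟨d, rfl⟩ := Nat.exists_eq_add_of_le hij
  rw [show i + d + 1 = d + (i + 1) by ring, Nat.add_comm i d, Function.iterate_add_apply,
    Function.iterate_add_apply (J l) d i]
  exact norm_iterate_sub_le hJ hl d _ _

theorem norm_iterate_sub_iterate_le (hJ : ∀ l, 0 < l → ∀ x, IsProx W l x (J l x)) {l : ℝ}
    (hl : 0 < l) (x : H) (i d : ℕ) :
    ‖(J l)^[i + d] x - (J l)^[i] x‖ ≤ d * ‖(J l)^[i + 1] x - (J l)^[i] x‖ := by
  induction d with
  | zero => simp
  | succ d ih =>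
    have h1 := norm_step_le hJ hl x (Nat.le_add_right i d)
    have h2 := norm_sub_le_norm_sub_add_norm_sub ((J l)^[i + d + 1] x) ((J l)^[i + d] x)
      ((J l)^[i] x)
    push_cast
    rw [← add_assoc]
    linarith

theorem norm_iterate_sub_self_le (hJ : ∀ l, 0 < l → ∀ x, IsProx W l x (J l x)) {l : ℝ}
    (hl : 0 < l) {x f : H} (hf : f ∈ subgradient W x) (k : ℕ) :
    ‖(J l)^[k] x - x‖ ≤ k * l * ‖f‖ := by
  have h1 := norm_iterate_sub_iterate_le hJ hl x 0 k
  have h2 := norm_sub_prox_le hJ hl hf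
  simp only [Nat.zero_add, Function.iterate_one, Function.iterate_zero, id] at h1
  calc _ ≤ _ := h1
    _ ≤ k * (l * ‖f‖) := by gcongr
    _ = _ := by ring

/-- The resolvent identity. -/
theorem IsProx.of_le {l m : ℝ} (hm : 0 < m) {x y : H} (h : IsProx W l x y) :
    IsProx W m ((m / l) • x + (1 - m / l) • y) y := by
  have e : m⁻¹ • ((m / l) • x + (1 - m / l) • y - y) = l⁻¹ • (x - y) := by
    have : (m / l) • x + (1 - m / l) • y - y = (m * l⁻¹) • (x - y) := by
      rw [div_eq_mul_inv]; module
    rw [this, smul_smul, ← mul_assoc, inv_mul_cancel₀ hm.ne', one_mul]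
  rw [IsProx, e]
  exact h

/-- The resolvent identity writes a step of length `l` as a step of length `m` from a convex
combination, so that the nonexpansive `J m` compares both sides. -/
theorem norm_iterate_sub_iterate_rec (hJ : ∀ l, 0 < l → ∀ x, IsProx W l x (J l x)) {l m : ℝ}
    (hm : 0 < m) (hml : m ≤ l) (x : H) (k j : ℕ) :
    ‖(J l)^[k + 1] x - (J m)^[j + 1] x‖ ≤ m / l * ‖(J l)^[k] x - (J m)^[j] x‖
      + (1 - m / l) * ‖(J l)^[k + 1] x - (J m)^[j] x‖ := by
  have hl : 0 < l := hm.trans_le hml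
  have h1 : 0 ≤ m / l := by positivity
  have h2 : 0 ≤ 1 - m / l := by rw [sub_nonneg, div_le_one hl]; exact hml
  rw [Function.iterate_succ_apply', Function.iterate_succ_apply']
  set y := (J l)^[k] x
  set z := (J m)^[j] x
  have h3 := ((hJ l hl y).of_le hm).norm_sub_le hm (hJ m hm z)
  have h4 : (m / l) • y + (1 - m / l) • J l y - z =
      (m / l) • (y - z) + (1 - m / l) • (J l y - z) := by module
  rw [h4] at h3
  refine h3.trans ((norm_add_le _ _).trans_eq ?_)
  rw [norm_smul, norm_smul, Real.norm_of_nonneg h1, Real.norm_of_nonneg h2]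

/-- The Crandall–Liggett estimate. The bound is the second moment of a random walk started at `k *
l` that moves down by `l` with probability `m / l` at each of `j` steps, minus nothing else: mean `k
* l - j * m`, variance `m * (l - m)` per step. It solves the recursion with equality, once the
square has been pulled inside by convexity. -/
theorem norm_iterate_sub_iterate_sq_le (hJ : ∀ l, 0 < l → ∀ x, IsProx W l x (J l x)) {l m : ℝ}
    (hm : 0 < m) (hml : m ≤ l) {x f : H} (hf : f ∈ subgradient W x) (k j : ℕ) :
    ‖(J l)^[k] x - (J m)^[j] x‖ ^ 2 ≤
      ‖f‖ ^ 2 * ((k * l - j * m) ^ 2 + j * m * (l - m)) := by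
  have hl : 0 < l := hm.trans_le hml
  induction j generalizing k with
  | zero =>
    have := norm_iterate_sub_self_le hJ hl hf k
    simp only [Function.iterate_zero, id]
    calc _ ≤ (k * l * ‖f‖) ^ 2 := by gcongr
      _ = _ := by push_cast; ring
  | succ j ih =>
    rcases k with _ | k
    · have := norm_iterate_sub_self_le hJ hm hf (j + 1)
      rw [Function.iterate_zero, id, norm_sub_rev]
      calc _ ≤ (((j + 1 : ℕ) : ℝ) * m * ‖f‖) ^ 2 := by gcongr
        _ ≤ _ := by
          have : 0 ≤ ‖f‖ ^ 2 * (((j + 1 : ℕ) : ℝ) * m * (l - m)) := by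
            have : 0 ≤ l - m := by linarith
            positivity
          push_cast at *
          nlinarith
    · have h1 := norm_iterate_sub_iterate_rec hJ hm hml x k j
      have h2 := ih k
      have h3 := ih (k + 1)
      set a := ‖(J l)^[k] x - (J m)^[j] x‖ with ha
      set b := ‖(J l)^[k + 1] x - (J m)^[j] x‖ with hb
      obtain ⟨r, hr⟩ : ∃ r, r = m / l := ⟨_, rfl⟩
      have hr0 : 0 ≤ r := by rw [hr]; positivity
      have hr1 : 0 ≤ 1 - r := by rw [hr, sub_nonneg, div_le_one hl]; exact hml
      have hm' : m = r * l := by rw [hr]; field_simp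
      rw [← hr] at h1
      calc _ ≤ (r * a + (1 - r) * b) ^ 2 := by gcongr
        _ ≤ r * a ^ 2 + (1 - r) * b ^ 2 := by
          nlinarith [mul_nonneg (mul_nonneg hr0 hr1) (sq_nonneg (a - b))]
        _ ≤ r * (‖f‖ ^ 2 * ((k * l - j * m) ^ 2 + j * m * (l - m))) + (1 - r) *
            (‖f‖ ^ 2 * ((((k + 1 : ℕ) : ℝ) * l - j * m) ^ 2 + j * m * (l - m))) := by gcongr
        _ = _ := by
          push_cast
          rw [hm']
          ring

theorem IsProx.toReal_le {l : ℝ} (hl : 0 < l) {x y v : H} (h : IsProx W l x y) (hv : W v < ∞) :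
    l * ((W y).toReal - (W v).toReal) ≤ 1 / 2 * ‖x - v‖ ^ 2 - 1 / 2 * ‖y - v‖ ^ 2 := by
  have h1 := (mem_subgradient_iff.1 h).2 v hv
  rw [inner_smul_left, conj_trivial] at h1
  have h2 : ‖x - v‖ ^ 2 = ‖x - y‖ ^ 2 - 2 * inner ℝ (x - y) (v - y) + ‖v - y‖ ^ 2 := by
    rw [← norm_sub_sq_real, sub_sub_sub_cancel_right]
  rw [h2, norm_sub_rev y v]
  have h3 : l * (l⁻¹ * inner ℝ (x - y) (v - y)) = inner ℝ (x - y) (v - y) := by field_simp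
  nlinarith [sq_nonneg ‖x - y‖]

theorem IsProx.energy_le {l : ℝ} {x y : H} (h : IsProx W l x y) (hx : W x < ∞) :
    (W y).toReal + l⁻¹ * ‖y - x‖ ^ 2 ≤ (W x).toReal := by
  have h1 := (mem_subgradient_iff.1 h).2 x hx
  rwa [inner_smul_left, conj_trivial, real_inner_self_eq_norm_sq, norm_sub_rev] at h1

theorem iterate_lt_top (hJ : ∀ l, 0 < l → ∀ x, IsProx W l x (J l x)) {l : ℝ} (hl : 0 < l)
    (x : H) {k : ℕ} (hk : k ≠ 0) : W ((J l)^[k] x) < ∞ := by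
  obtain ⟨k, rfl⟩ := Nat.exists_eq_succ_of_ne_zero hk
  rw [Function.iterate_succ_apply']
  exact (hJ l hl _).1

/-- The discrete evolution variational inequality. -/
theorem iterate_toReal_le (hJ : ∀ l, 0 < l → ∀ x, IsProx W l x (J l x)) {l : ℝ} (hl : 0 < l)
    (x : H) {v : H} (hv : W v < ∞) (k : ℕ) :
    k * l * ((W ((J l)^[k] x)).toReal - (W v).toReal) ≤
      1 / 2 * ‖x - v‖ ^ 2 - 1 / 2 * ‖(J l)^[k] x - v‖ ^ 2 := by
  induction k with
  | zero => simp
  | succ k ih =>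
    have h1 := (hJ l hl ((J l)^[k] x)).toReal_le hl hv
    rw [← Function.iterate_succ_apply' (J l)] at h1
    -- The energy decreases along the scheme, so the newest value may replace the older ones. The
    -- case `k = 0` is separate because `W x` may be infinite.
    have h2 : k * l * (W ((J l)^[k + 1] x)).toReal ≤ k * l * (W ((J l)^[k] x)).toReal := by
      rcases eq_or_ne k 0 with rfl | hk
      · simp
      · have := (hJ l hl ((J l)^[k] x)).energy_le (iterate_lt_top hJ hl x hk)
        rw [← Function.iterate_succ_apply' (J l)] at this
        have h3 : 0 ≤ l⁻¹ * ‖(J l)^[k + 1] x - (J l)^[k] x‖ ^ 2 := by positivity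
        exact mul_le_mul_of_nonneg_left (by linarith) (by positivity)
    push_cast
    linarith

/-- Each step lowers the energy by at least `l⁻¹ ‖step‖²`, and step lengths decrease, so the latest
one can be counted `k` times. -/
theorem iterate_step_energy_le (hJ : ∀ l, 0 < l → ∀ x, IsProx W l x (J l x)) {l : ℝ}
    (hl : 0 < l) {x : H} (hx : W x < ∞) (k : ℕ) :
    k * l⁻¹ * ‖(J l)^[k + 1] x - (J l)^[k] x‖ ^ 2 + (W ((J l)^[k] x)).toReal ≤ (W x).toReal := by
  induction k with
  | zero => simp
  | succ k ih =>
    have h0 : W ((J l)^[k] x) < ∞ := by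
      rcases eq_or_ne k 0 with rfl | hk
      · exact hx
      · exact iterate_lt_top hJ hl x hk
    have h1 := (hJ l hl ((J l)^[k] x)).energy_le h0
    rw [← Function.iterate_succ_apply' (J l)] at h1
    have h2 := norm_step_le hJ hl x (Nat.le_succ k)
    have h3 : ((k + 1 : ℕ) : ℝ) * l⁻¹ * ‖(J l)^[k + 1 + 1] x - (J l)^[k + 1] x‖ ^ 2 ≤
        ((k + 1 : ℕ) : ℝ) * l⁻¹ * ‖(J l)^[k + 1] x - (J l)^[k] x‖ ^ 2 := by gcongr
    push_cast at *
    linarith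

/-- The regularising effect of the scheme. -/
theorem iterate_speed_sq_le (hJ : ∀ l, 0 < l → ∀ x, IsProx W l x (J l x)) {l : ℝ} (hl : 0 < l)
    (x : H) {v : H} (hv : W v < ∞) {k i : ℕ} (hki : 2 * k ≤ i) {T : ℝ} (hT : 0 < T)
    (hkT : T ≤ k * l) :
    ‖(J l)^[i + 1] x - (J l)^[i] x‖ ^ 2 ≤
      l ^ 2 * (((W v).toReal + ‖x - v‖ ^ 2 / (2 * T)) / T) := by
  have hk : k ≠ 0 := by
    rintro rfl
    simp at hkT
    linarith
  -- The first `k` steps make the energy finite with an explicit bound; the next `k` convert this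
  -- energy into a bound on the step length.
  have h1 := norm_step_le hJ hl x hki
  have h2 := iterate_step_energy_le hJ hl (iterate_lt_top hJ hl x hk) k
  rw [← Function.iterate_add_apply, ← Function.iterate_add_apply,
    show k + 1 + k = 2 * k + 1 by ring, show k + k = 2 * k by ring] at h2
  have h3 := iterate_toReal_le hJ hl x hv k
  set D := ‖(J l)^[2 * k + 1] x - (J l)^[2 * k] x‖
  set w := (W ((J l)^[k] x)).toReal
  have hw : w ≤ (W v).toReal + ‖x - v‖ ^ 2 / (2 * T) := by
    rcases le_total w (W v).toReal with h | h
    · have : 0 ≤ ‖x - v‖ ^ 2 / (2 * T) := by positivity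
      linarith
    · have h4 : T * (w - (W v).toReal) ≤ 1 / 2 * ‖x - v‖ ^ 2 := by
        have := mul_le_mul_of_nonneg_right hkT (sub_nonneg.2 h)
        nlinarith [sq_nonneg ‖(J l)^[k] x - v‖]
      have h5 : w - (W v).toReal ≤ ‖x - v‖ ^ 2 / (2 * T) := by
        rw [le_div_iff₀ (by positivity)]; linarith
      linarith
  have hD : k * l⁻¹ * D ^ 2 ≤ w := by
    have : 0 ≤ (W ((J l)^[2 * k] x)).toReal := ENNReal.toReal_nonneg
    linarith
  have hD2 : T * D ^ 2 ≤ l ^ 2 * w := by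
    calc T * D ^ 2 ≤ k * l * D ^ 2 := by gcongr
      _ = l ^ 2 * (k * l⁻¹ * D ^ 2) := by field_simp
      _ ≤ _ := by gcongr
  calc _ ≤ D ^ 2 := by gcongr
    _ ≤ l ^ 2 * (w / T) := by
      rw [← mul_div_assoc, le_div_iff₀ hT]; linarith
    _ ≤ _ := by gcongr

end Euler

/-! ### Convergence of the Euler scheme and properties of its limit -/

section EulerLimit

variable {H : Type*} [NormedAddCommGroup H] [InnerProductSpace ℝ H] {W : H → ℝ≥0∞}
  {J : ℝ → H → H}

/-- The Euler approximation with step `1 / (n + 1)`. -/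
def euler {E : Type*} (J : ℝ → E → E) (n : ℕ) (t : ℝ) (x : E) : E :=
  (J (1 / ((n : ℝ) + 1)))^[⌊t * ((n : ℝ) + 1)⌋₊] x

theorem euler_zero {E : Type*} (J : ℝ → E → E) (n : ℕ) (x : E) : euler J n 0 x = x := by
  simp [euler]

theorem norm_euler_sub_le (hJ : ∀ l, 0 < l → ∀ x, IsProx W l x (J l x)) (n : ℕ) (t : ℝ)
    (x y : H) : ‖euler J n t x - euler J n t y‖ ≤ ‖x - y‖ :=
  norm_iterate_sub_le hJ (by positivity) _ _ _

theorem tendsto_one_div_succ : Tendsto (fun n : ℕ => 1 / ((n : ℝ) + 1)) atTop (𝓝 0) :=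
  tendsto_one_div_add_atTop_nhds_zero_nat

theorem floor_mul_le {t : ℝ} (ht : 0 ≤ t) (n : ℕ) :
    (⌊t * ((n : ℝ) + 1)⌋₊ : ℝ) * (1 / ((n : ℝ) + 1)) ≤ t := by
  have h := Nat.floor_le (a := t * ((n : ℝ) + 1)) (by positivity)
  rw [mul_one_div, div_le_iff₀ (by positivity)]
  exact h

theorem lt_floor_mul_add (t : ℝ) (n : ℕ) :
    t < (⌊t * ((n : ℝ) + 1)⌋₊ : ℝ) * (1 / ((n : ℝ) + 1)) + 1 / ((n : ℝ) + 1) := by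
  have h := Nat.lt_floor_add_one (t * ((n : ℝ) + 1))
  rw [mul_one_div, ← add_div, lt_div_iff₀ (by positivity)]
  exact h

theorem tendsto_floor_mul {t : ℝ} (ht : 0 ≤ t) :
    Tendsto (fun n : ℕ => (⌊t * ((n : ℝ) + 1)⌋₊ : ℝ) * (1 / ((n : ℝ) + 1))) atTop (𝓝 t) := by
  have h0 : Tendsto (fun n : ℕ => t - 1 / ((n : ℝ) + 1)) atTop (𝓝 t) := by
    simpa using tendsto_one_div_succ.const_sub t
  exact tendsto_of_tendsto_of_tendsto_of_le_of_le h0 tendsto_const_nhds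
    (fun n => by linarith [lt_floor_mul_add t n]) (fun n => floor_mul_le ht n)

/-- The rounded times differ by at most `l = 1 / (n + 1) ≤ 1`, so the two terms of the
Crandall–Liggett bound are at most `l² ≤ l` and `t * l`. -/
theorem norm_euler_sub_euler_le (hJ : ∀ l, 0 < l → ∀ x, IsProx W l x (J l x)) {x f : H}
    (hf : f ∈ subgradient W x) {t : ℝ} (ht : 0 ≤ t) {n m : ℕ} (hnm : n ≤ m) :
    ‖euler J n t x - euler J m t x‖ ≤ ‖f‖ * Real.sqrt ((1 + t) * (1 / ((n : ℝ) + 1))) := by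
  have h := norm_iterate_sub_iterate_sq_le hJ (l := 1 / ((n : ℝ) + 1)) (m := 1 / ((m : ℝ) + 1))
    (by positivity) (Nat.one_div_le_one_div hnm) hf ⌊t * ((n : ℝ) + 1)⌋₊ ⌊t * ((m : ℝ) + 1)⌋₊
  have a1 := floor_mul_le ht n
  have a2 := floor_mul_le ht m
  have a3 := lt_floor_mul_add t n
  have a4 := lt_floor_mul_add t m
  have a5 : 1 / ((m : ℝ) + 1) ≤ 1 / ((n : ℝ) + 1) := Nat.one_div_le_one_div hnm
  have a6 : 0 < 1 / ((m : ℝ) + 1) := by positivity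
  have a7 : 1 / ((n : ℝ) + 1) ≤ 1 := by
    rw [div_le_one (by positivity)]; linarith [n.cast_nonneg (α := ℝ)]
  have a8 : 0 ≤ (⌊t * ((m : ℝ) + 1)⌋₊ : ℝ) * (1 / ((m : ℝ) + 1)) := by positivity
  change ‖euler J n t x - euler J m t x‖ ^ 2 ≤ _ at h
  set a := (⌊t * ((n : ℝ) + 1)⌋₊ : ℝ) * (1 / ((n : ℝ) + 1))
  set b := (⌊t * ((m : ℝ) + 1)⌋₊ : ℝ) * (1 / ((m : ℝ) + 1))
  set l := 1 / ((n : ℝ) + 1)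
  set l' := 1 / ((m : ℝ) + 1)
  have h1 : (a - b) ^ 2 + b * (l - l') ≤ (1 + t) * l := by
    have e1 : (a - b) ^ 2 ≤ l ^ 2 := sq_le_sq' (by linarith) (by linarith)
    nlinarith
  have h2 : ‖euler J n t x - euler J m t x‖ ^ 2 ≤ ‖f‖ ^ 2 * ((1 + t) * l) :=
    h.trans (by gcongr)
  rw [← Real.sqrt_sq (norm_nonneg f), ← Real.sqrt_mul (sq_nonneg _)]
  exact Real.le_sqrt_of_sq_le h2

/-- Points at which `W` has a subgradient are dense in the closure of the effective domain. -/
theorem exists_subgradient_near (hJ : ∀ l, 0 < l → ∀ x, IsProx W l x (J l x)) {x : H}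
    (hx : x ∈ closure (effDomain W)) {ε : ℝ} (hε : 0 < ε) :
    ∃ y f, f ∈ subgradient W y ∧ ‖x - y‖ < ε := by
  obtain ⟨z, hz, hxz⟩ := Metric.mem_closure_iff.1 hx (ε / 2) (by positivity)
  obtain ⟨l, hl, hlW⟩ : ∃ l : ℝ, 0 < l ∧ l * (W z).toReal < (ε / 2) ^ 2 := by
    have hw : 0 ≤ (W z).toReal := ENNReal.toReal_nonneg
    -- A resolvent step moves `z` by at most `√(l * W z)`; the `+ 1` covers `W z = 0`.
    refine ⟨(ε / 2) ^ 2 / ((W z).toReal + 1), by positivity, ?_⟩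
    rw [div_mul_eq_mul_div, div_lt_iff₀ (by positivity)]
    nlinarith [sq_nonneg (ε / 2), pow_pos (half_pos hε) 2]
  have h := (hJ l hl z).energy_le hz
  have h0 : 0 ≤ (W (J l z)).toReal := ENNReal.toReal_nonneg
  have h1 : ‖J l z - z‖ ^ 2 ≤ l * (W z).toReal := by
    have : l * (l⁻¹ * ‖J l z - z‖ ^ 2) = ‖J l z - z‖ ^ 2 := by field_simp
    nlinarith
  have h2 : ‖J l z - z‖ < ε / 2 := lt_of_pow_lt_pow_left₀ 2 (by positivity) (h1.trans_lt hlW)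
  refine ⟨J l z, _, hJ l hl z, ?_⟩
  rw [dist_eq_norm] at hxz
  have h3 := norm_sub_le_norm_sub_add_norm_sub x z (J l z)
  rw [norm_sub_rev z] at h3
  linarith

/-- The rate is available only at points with a subgradient. These are dense, and all approximations
are nonexpansive, so convergence carries over without a rate. -/
theorem cauchySeq_euler (hJ : ∀ l, 0 < l → ∀ x, IsProx W l x (J l x)) {x : H}
    (hx : x ∈ closure (effDomain W)) {t : ℝ} (ht : 0 ≤ t) :
    CauchySeq fun n => euler J n t x := by
  rw [Metric.cauchySeq_iff']
  intro ε hε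
  obtain ⟨y, f, hf, hxy⟩ := exists_subgradient_near hJ hx (show 0 < ε / 4 by positivity)
  have hlim : Tendsto (fun n : ℕ => ‖f‖ * Real.sqrt ((1 + t) * (1 / ((n : ℝ) + 1)))) atTop
      (𝓝 (‖f‖ * Real.sqrt ((1 + t) * 0))) :=
    ((Real.continuous_sqrt.tendsto _).comp (tendsto_one_div_succ.const_mul _)).const_mul _
  rw [mul_zero, Real.sqrt_zero, mul_zero] at hlim
  obtain ⟨N, hN⟩ := (hlim.eventually (gt_mem_nhds (show 0 < ε / 4 by positivity))).exists
  refine ⟨N, fun n hn => ?_⟩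
  rw [dist_comm, dist_eq_norm]
  have h1 := norm_euler_sub_euler_le hJ hf ht hn
  have h2 := norm_euler_sub_le hJ N t x y
  have h3 := norm_euler_sub_le hJ n t x y
  have h4 : euler J N t x - euler J n t x = (euler J N t x - euler J N t y)
      + (euler J N t y - euler J n t y) - (euler J n t x - euler J n t y) := by abel
  rw [h4]
  have h5 := norm_sub_le ((euler J N t x - euler J N t y)
      + (euler J N t y - euler J n t y)) (euler J n t x - euler J n t y)
  have h6 := norm_add_le (euler J N t x - euler J N t y) (euler J N t y - euler J n t y)
  linarith

/-- The evolution variational inequality for the limit of the Euler scheme. -/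
theorem euler_limit_energy_le (hJ : ∀ l, 0 < l → ∀ x, IsProx W l x (J l x))
    (hl : LowerSemicontinuous W) {x : H} {u : ℝ → H}
    (hu : ∀ t, 0 ≤ t → Tendsto (fun n => euler J n t x) atTop (𝓝 (u t))) {s t : ℝ} (hs : 0 ≤ s)
    (hst : s < t) {v : H} (hv : W v < ∞) :
    W (u t) < ∞ ∧ (W (u t)).toReal ≤
      (W v).toReal + (1 / 2 * ‖u s - v‖ ^ 2 - 1 / 2 * ‖u t - v‖ ^ 2) / (t - s) := by
  have ht : 0 ≤ t := hs.trans hst.le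
  have hτ : Tendsto (fun n : ℕ => (⌊t * ((n : ℝ) + 1)⌋₊ : ℝ) * (1 / ((n : ℝ) + 1))
      - (⌊s * ((n : ℝ) + 1)⌋₊ : ℝ) * (1 / ((n : ℝ) + 1))) atTop (𝓝 (t - s)) :=
    (tendsto_floor_mul ht).sub (tendsto_floor_mul hs)
  refine le_of_tendsto_of_lsc hl (hu t ht)
    (c := fun n => (W v).toReal + (1 / 2 * ‖euler J n s x - v‖ ^ 2
      - 1 / 2 * ‖euler J n t x - v‖ ^ 2) / ((⌊t * ((n : ℝ) + 1)⌋₊ : ℝ) * (1 / ((n : ℝ) + 1))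
      - (⌊s * ((n : ℝ) + 1)⌋₊ : ℝ) * (1 / ((n : ℝ) + 1)))) ?_ ?_
  · refine Tendsto.const_add _ (Tendsto.div (Tendsto.sub ?_ ?_) hτ (sub_pos.2 hst).ne')
    · exact ((((hu s hs).sub_const v).norm).pow 2).const_mul _
    · exact ((((hu t ht).sub_const v).norm).pow 2).const_mul _
  · filter_upwards [hτ.eventually (lt_mem_nhds (sub_pos.2 hst))] with n hn
    have hpos : (0 : ℝ) < 1 / ((n : ℝ) + 1) := by positivity
    have hle : ⌊s * ((n : ℝ) + 1)⌋₊ ≤ ⌊t * ((n : ℝ) + 1)⌋₊ := by gcongr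
    -- With the step size fixed, the scheme up to `t` is the scheme up to `s` followed by `d` steps,
    -- so the discrete inequality can be restarted at `s`. For large `n`, `d` is nonzero, which
    -- makes the energy finite.
    obtain ⟨d, hd⟩ := Nat.exists_eq_add_of_le hle
    have hd' : (d : ℝ) * (1 / ((n : ℝ) + 1)) = (⌊t * ((n : ℝ) + 1)⌋₊ : ℝ) * (1 / ((n : ℝ) + 1))
      - (⌊s * ((n : ℝ) + 1)⌋₊ : ℝ) * (1 / ((n : ℝ) + 1)) := by
      rw [hd]; push_cast; ring
    have e : euler J n t x = (J (1 / ((n : ℝ) + 1)))^[d] (euler J n s x) := by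
      rw [euler, euler, hd, Nat.add_comm, Function.iterate_add_apply]
    have h1 := iterate_toReal_le hJ hpos (euler J n s x) hv d
    rw [← e, hd'] at h1
    refine ⟨?_, ?_⟩
    · rw [euler]
      refine iterate_lt_top hJ hpos x fun h0 => ?_
      rw [← hd'] at hn
      have : d = 0 := by omega
      simp [this] at hn
    · rw [mul_comm, ← le_div_iff₀ hn] at h1
      linarith

/-- The limit of the Euler scheme is Lipschitz continuous away from the initial time. -/
theorem euler_limit_lipschitz (hJ : ∀ l, 0 < l → ∀ x, IsProx W l x (J l x)) {x : H} {u : ℝ → H}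
    (hu : ∀ t, 0 ≤ t → Tendsto (fun n => euler J n t x) atTop (𝓝 (u t))) {v : H} (hv : W v < ∞)
    {a : ℝ} (ha : 0 < a) : ∃ C : ℝ, 0 ≤ C ∧
      ∀ s t, a ≤ s → s ≤ t → ‖u t - u s‖ ≤ C * (t - s) := by
  -- The speed bound with `T = a / 4`: for small steps, `⌊(a / 2)(n + 1)⌋` steps cover at least time
  -- `a / 4`, and twice as many fit before `s ≥ a`.
  refine ⟨Real.sqrt (((W v).toReal + ‖x - v‖ ^ 2 / (2 * (a / 4))) / (a / 4)),
    Real.sqrt_nonneg _, fun s t has hst => ?_⟩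
  set C := Real.sqrt (((W v).toReal + ‖x - v‖ ^ 2 / (2 * (a / 4))) / (a / 4)) with hC
  have hs : 0 ≤ s := ha.le.trans has
  have ht : 0 ≤ t := hs.trans hst
  have hτ : Tendsto (fun n : ℕ => (⌊t * ((n : ℝ) + 1)⌋₊ : ℝ) * (1 / ((n : ℝ) + 1))
      - (⌊s * ((n : ℝ) + 1)⌋₊ : ℝ) * (1 / ((n : ℝ) + 1))) atTop (𝓝 (t - s)) :=
    (tendsto_floor_mul ht).sub (tendsto_floor_mul hs)
  refine le_of_tendsto_of_tendsto ((hu t ht).sub (hu s hs)).norm (hτ.const_mul C) ?_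
  filter_upwards [tendsto_one_div_succ.eventually (gt_mem_nhds (show 0 < a / 4 by positivity))]
    with n hn
  have hpos : (0 : ℝ) < 1 / ((n : ℝ) + 1) := by positivity
  have hle : ⌊s * ((n : ℝ) + 1)⌋₊ ≤ ⌊t * ((n : ℝ) + 1)⌋₊ := by gcongr
  obtain ⟨d, hd⟩ := Nat.exists_eq_add_of_le hle
  have hk : 2 * ⌊a / 2 * ((n : ℝ) + 1)⌋₊ ≤ ⌊s * ((n : ℝ) + 1)⌋₊ := by
    apply Nat.le_floor
    have := Nat.floor_le (a := a / 2 * ((n : ℝ) + 1)) (by positivity)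
    push_cast
    nlinarith [n.cast_nonneg (α := ℝ)]
  have hkT : a / 4 ≤ (⌊a / 2 * ((n : ℝ) + 1)⌋₊ : ℝ) * (1 / ((n : ℝ) + 1)) := by
    linarith [lt_floor_mul_add (a / 2) n]
  have h1 := iterate_speed_sq_le hJ hpos x hv hk (show 0 < a / 4 by positivity) hkT
  have h2 := norm_iterate_sub_iterate_le hJ hpos x ⌊s * ((n : ℝ) + 1)⌋₊ d
  rw [← hd] at h2
  have hCsq : C ^ 2 = ((W v).toReal + ‖x - v‖ ^ 2 / (2 * (a / 4))) / (a / 4) := by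
    have : 0 ≤ (W v).toReal := ENNReal.toReal_nonneg
    exact Real.sq_sqrt (by positivity)
  rw [← hCsq, ← mul_pow] at h1
  have h3 := (pow_le_pow_iff_left₀ (norm_nonneg _)
    (mul_nonneg hpos.le (Real.sqrt_nonneg _)) two_ne_zero).1 h1
  change ‖euler J n t x - euler J n s x‖ ≤ _ at h2
  calc _ ≤ _ := h2
    _ ≤ d * (1 / ((n : ℝ) + 1) * C) := by gcongr
    _ = C * ((⌊t * ((n : ℝ) + 1)⌋₊ : ℝ) * (1 / ((n : ℝ) + 1))
      - (⌊s * ((n : ℝ) + 1)⌋₊ : ℝ) * (1 / ((n : ℝ) + 1))) := by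
      rw [hd]; push_cast; ring

/-- The limit of the Euler scheme attains its initial value. -/
theorem euler_limit_tendsto_zero (hJ : ∀ l, 0 < l → ∀ x, IsProx W l x (J l x)) {x : H}
    (hx : x ∈ closure (effDomain W)) {u : ℝ → H}
    (hu : ∀ t, 0 ≤ t → Tendsto (fun n => euler J n t x) atTop (𝓝 (u t))) {ε : ℝ} (hε : 0 < ε) :
    ∃ δ > 0, ∀ t, 0 ≤ t → t < δ → ‖u t - x‖ ≤ ε := by
  obtain ⟨y, f, hf, hxy⟩ := exists_subgradient_near hJ hx (show 0 < ε / 4 by positivity)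
  -- Starting from the nearby point `y`, the scheme moves with speed at most `‖f‖`.
  refine ⟨ε / 4 / (‖f‖ + 1), by positivity, fun t ht0 htδ => ?_⟩
  refine le_of_tendsto ((hu t ht0).sub_const x).norm (Eventually.of_forall fun n => ?_)
  have h1 := norm_euler_sub_le hJ n t x y
  have h2 : ‖euler J n t y - y‖ ≤ t * ‖f‖ := by
    refine (norm_iterate_sub_self_le hJ (by positivity) hf _).trans ?_
    gcongr
    exact floor_mul_le ht0 n
  have h3 : t * ‖f‖ ≤ ε / 4 := by
    rw [lt_div_iff₀ (by positivity)] at htδ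
    nlinarith
  have h4 : euler J n t x - x = (euler J n t x - euler J n t y) + (euler J n t y - y)
      - (x - y) := by abel
  rw [h4]
  have h5 := norm_sub_le ((euler J n t x - euler J n t y) + (euler J n t y - y)) (x - y)
  have h6 := norm_add_le (euler J n t x - euler J n t y) (euler J n t y - y)
  linarith

end EulerLimit

/-! ### Lipschitz curves in a Hilbert space -/

section Lipschitz

variable {H : Type*} [NormedAddCommGroup H] [InnerProductSpace ℝ H] [CompleteSpace H]

/-- A bounded sequence in a Hilbert space converges weakly along an ultrafilter. -/
theorem exists_weak_limit {x : ℕ → H} {K : ℝ} (hx : ∀ n, ‖x n‖ ≤ K) :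
    ∃ y : H, ∀ z : H, Tendsto (fun n => inner ℝ (x n) z) (hyperfilter ℕ : Filter ℕ)
      (𝓝 (inner ℝ y z)) := by
  have hc := WeakDual.isCompact_closedBall (𝕜 := ℝ) (E := H) 0 K
  set φ : ℕ → WeakDual ℝ H := fun n =>
    StrongDual.toWeakDual (InnerProductSpace.toDual ℝ H (x n)) with hφ
  have hmem : ∀ n, φ n ∈ WeakDual.toStrongDual ⁻¹' Metric.closedBall (0 : StrongDual ℝ H) K := by
    intro n
    rw [mem_preimage, mem_closedBall_zero_iff]
    have : WeakDual.toStrongDual (φ n) = InnerProductSpace.toDual ℝ H (x n) := rfl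
    rw [this, LinearIsometryEquiv.norm_map]
    exact hx n
  obtain ⟨ℓ, -, hℓ⟩ := hc.ultrafilter_le_nhds ((hyperfilter ℕ).map φ) (by
    rw [le_principal_iff]
    exact Eventually.of_forall (f := (hyperfilter ℕ : Filter ℕ)) hmem)
  refine ⟨(InnerProductSpace.toDual ℝ H).symm (WeakDual.toStrongDual ℓ), fun z => ?_⟩
  rw [InnerProductSpace.toDual_symm_apply]
  have h1 : Tendsto φ (hyperfilter ℕ : Filter ℕ) (𝓝 ℓ) := hℓ
  exact ((WeakDual.eval_continuous z).tendsto ℓ).comp h1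

/-- The integral is the difference of two slopes, at `t` and at `a`, of a primitive of `u`. -/
theorem tendsto_integral_differenceQuotient {u : ℝ → H} (hu : Continuous u) (a t : ℝ) :
    Tendsto (fun n : ℕ => ∫ s in a..t,
      ((n : ℝ) + 1) • (u (s + 1 / ((n : ℝ) + 1)) - u s)) atTop (𝓝 (u t - u a)) := by
  set F : ℝ → H := fun x => ∫ s in (0 : ℝ)..x, u s with hF
  have hint : ∀ a b, IntervalIntegrable u volume a b := fun a b => hu.intervalIntegrable a b
  have hder : ∀ x, HasDerivAt F (u x) x := fun x =>
    intervalIntegral.integral_hasDerivAt_right (hint 0 x)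
      hu.stronglyMeasurable.stronglyMeasurableAtFilter hu.continuousAt
  have hseq : Tendsto (fun n : ℕ => 1 / ((n : ℝ) + 1)) atTop (𝓝[≠] 0) := by
    rw [tendsto_nhdsWithin_iff]
    exact ⟨tendsto_one_div_succ, Eventually.of_forall fun n => by
      simp only [mem_compl_iff, mem_singleton_iff]; positivity⟩
  have hlim : ∀ x, Tendsto (fun n : ℕ => (1 / ((n : ℝ) + 1))⁻¹ • (F (x + 1 / ((n : ℝ) + 1)) - F x))
      atTop (𝓝 (u x)) := fun x => (hder x).tendsto_slope_zero.comp hseq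
  refine ((hlim t).sub (hlim a)).congr fun n => ?_
  rw [intervalIntegral.integral_smul, intervalIntegral.integral_sub _ (hint a t),
    intervalIntegral.integral_comp_add_right, ← smul_sub, one_div, inv_inv]
  · congr 1
    have e1 : ∀ x y, ∫ s in x..y, u s = F y - F x := fun x y =>
      (intervalIntegral.integral_interval_sub_left (hint 0 y) (hint 0 x)).symm
    rw [e1, e1]
    abel
  · exact (hu.comp (continuous_id.add continuous_const)).intervalIntegrable _ _

/-- The difference quotients are bounded in `L²(a, b; H)`, so they have a weak limit `g`. Testing
against `y` times the indicator of `(a, t]` identifies the integral of `g`. -/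
theorem LipschitzWith.exists_primitive {u : ℝ → H} {C : ℝ≥0} (hu : LipschitzWith C u) {a b : ℝ} :
    ∃ g : ℝ → H, IntegrableOn g (Ioc a b) ∧
      ∀ t ∈ Icc a b, u t - u a = ∫ s in a..t, g s := by
  set ν : Measure ℝ := volume.restrict (Ioc a b) with hν
  have hfin : IsFiniteMeasure ν := by rw [hν]; infer_instance
  set q : ℕ → ℝ → H := fun n s => ((n : ℝ) + 1) • (u (s + 1 / ((n : ℝ) + 1)) - u s) with hq
  have hqc : ∀ n, Continuous (q n) := by
    intro n
    have := hu.continuous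
    fun_prop
  have hqb : ∀ n s, ‖q n s‖ ≤ C := by
    intro n s
    have h := hu.dist_le_mul (s + 1 / ((n : ℝ) + 1)) s
    rw [dist_eq_norm, dist_eq_norm, add_sub_cancel_left, Real.norm_of_nonneg (by positivity)] at h
    rw [norm_smul, Real.norm_of_nonneg (by positivity)]
    calc _ ≤ ((n : ℝ) + 1) * (C * (1 / ((n : ℝ) + 1))) := by gcongr
      _ = C := by field_simp
  have hqm : ∀ n, MemLp (q n) 2 ν := fun n =>
    MemLp.of_bound (hqc n).aestronglyMeasurable C (Eventually.of_forall (hqb n))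
  set G : ℕ → Lp H 2 ν := fun n => (hqm n).toLp (q n) with hG
  obtain ⟨g, hg⟩ := exists_weak_limit (x := G) (fun n => Lp.norm_le_of_ae_bound (C := C)
    C.2 ((hqm n).coeFn_toLp.mono fun s hs => by rw [hs]; exact hqb n s))
  have hgint : Integrable g ν := (Lp.memLp g).integrable (by norm_num)
  refine ⟨g, hgint, fun t ht => ?_⟩
  have hsub : Ioc a t ⊆ Ioc a b := Ioc_subset_Ioc_right ht.2
  have hrestrict : ∀ f : ℝ → H, ∫ s in Ioc a t, f s ∂ν = ∫ s in a..t, f s := by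
    intro f
    rw [hν, Measure.restrict_restrict measurableSet_Ioc, inter_eq_left.2 hsub,
      intervalIntegral.integral_of_le ht.1]
  refine ext_inner_left ℝ fun y => ?_
  have h1 : Tendsto (fun n => inner ℝ y (∫ s in a..t, q n s)) (hyperfilter ℕ : Filter ℕ)
      (𝓝 (inner ℝ y (u t - u a))) :=
    (((innerSL ℝ y).continuous.tendsto _).comp
      (tendsto_integral_differenceQuotient hu.continuous a t)).mono_left Nat.hyperfilter_le_atTop
  have h2 := hg (indicatorConstLp 2 (measurableSet_Ioc (a := a) (b := t)) (measure_ne_top ν _) y)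
  have e : ∀ f : Lp H 2 ν, inner ℝ f
      (indicatorConstLp 2 (measurableSet_Ioc (a := a) (b := t)) (measure_ne_top ν _) y)
      = inner ℝ y (∫ s in a..t, f s) := by
    intro f
    rw [real_inner_comm, L2.inner_indicatorConstLp_eq_inner_setIntegral ℝ, hrestrict]
  simp only [e] at h2
  have e2 : ∀ n, ∫ s in a..t, G n s = ∫ s in a..t, q n s := by
    intro n
    rw [← hrestrict, ← hrestrict]
    exact integral_congr_ae (ae_restrict_of_ae (hqm n).coeFn_toLp)
  simp only [e2] at h2
  exact tendsto_nhds_unique h1 h2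

theorem LipschitzWith.ae_differentiableAt_hilbert {u : ℝ → H} {C : ℝ≥0} (hu : LipschitzWith C u) :
    ∀ᵐ t, DifferentiableAt ℝ u t := by
  have key : ∀ n : ℕ, ∀ᵐ t, t ∈ Ioo (-(n : ℝ)) n → DifferentiableAt ℝ u t := by
    intro n
    obtain ⟨g, hg, hgu⟩ := LipschitzWith.exists_primitive hu (a := -(n : ℝ)) (b := n)
    have hle : -(n : ℝ) ≤ n := by linarith [n.cast_nonneg (α := ℝ)]
    have hint : IntervalIntegrable g volume (-(n : ℝ)) n :=
      (intervalIntegrable_iff_integrableOn_Ioc_of_le hle).2 hg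
    filter_upwards [hint.ae_hasDerivAt_integral] with t ht htn
    have h1 := ht (by rw [uIcc_of_le hle]; exact Ioo_subset_Icc_self htn) (-(n : ℝ)) left_mem_uIcc
    have h2 : (fun x => u x) =ᶠ[𝓝 t] fun x => u (-(n : ℝ)) + ∫ s in (-(n : ℝ))..x, g s := by
      filter_upwards [Ioo_mem_nhds htn.1 htn.2] with x hx
      rw [← hgu x (Ioo_subset_Icc_self hx)]
      abel
    exact ((h1.const_add _).congr_of_eventuallyEq h2).differentiableAt
  filter_upwards [ae_all_iff.2 key] with t ht
  obtain ⟨n, hn⟩ := exists_nat_gt |t|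
  exact ht n (abs_lt.1 hn)

theorem LipschitzWith.integral_deriv_hilbert {u : ℝ → H} {C : ℝ≥0} (hu : LipschitzWith C u)
    {a b : ℝ} (hab : a ≤ b) : u b - u a = ∫ s in a..b, deriv u s := by
  obtain ⟨g, hg, hgu⟩ := LipschitzWith.exists_primitive hu (a := a) (b := b)
  have hint : IntervalIntegrable g volume a b :=
    (intervalIntegrable_iff_integrableOn_Ioc_of_le hab).2 hg
  rw [hgu b (right_mem_Icc.2 hab)]
  refine intervalIntegral.integral_congr_ae ?_
  filter_upwards [hint.ae_hasDerivAt_integral, compl_mem_ae_iff.2 (measure_singleton b)]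
    with t ht htb htab
  rw [uIoc_of_le hab] at htab
  have htn : t ∈ Ioo a b := ⟨htab.1, lt_of_le_of_ne htab.2 htb⟩
  have h1 := ht (by rw [uIcc_of_le hab]; exact Ioo_subset_Icc_self htn) a left_mem_uIcc
  have h2 : (fun x => u x) =ᶠ[𝓝 t] fun x => u a + ∫ s in a..x, g s := by
    filter_upwards [Ioo_mem_nhds htn.1 htn.2] with x hx
    rw [← hgu x (Ioo_subset_Icc_self hx)]
    abel
  exact ((h1.const_add _).congr_of_eventuallyEq h2).deriv.symm

end Lipschitz

/-! ### Existence of gradient flows -/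

section Existence

variable {H : Type*} [NormedAddCommGroup H] [InnerProductSpace ℝ H] {W : H → ℝ≥0∞}

/-- Let `s ↑ t` in the variational inequality: the quotient tends to `-⟨u t - v, u' t⟩`, the
derivative of `-‖u - v‖² / 2`. -/
theorem neg_deriv_mem_subgradient {u : ℝ → H} {t : ℝ} (ht : 0 < t) (hd : DifferentiableAt ℝ u t)
    (hW : W (u t) < ∞)
    (hevi : ∀ s, 0 ≤ s → s < t → ∀ v, W v < ∞ → (W (u t)).toReal ≤
      (W v).toReal + (1 / 2 * ‖u s - v‖ ^ 2 - 1 / 2 * ‖u t - v‖ ^ 2) / (t - s)) :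
    -deriv u t ∈ subgradient W (u t) := by
  refine mem_subgradient_iff.2 ⟨hW, fun v hv => ?_⟩
  have h1 : HasDerivAt (fun s => 1 / 2 * ‖u s - v‖ ^ 2)
      (1 / 2 * (2 * inner ℝ (u t - v) (deriv u t))) t :=
    ((hd.hasDerivAt.sub_const v).norm_sq).const_mul _
  have h2 := h1.tendsto_slope.mono_left (nhdsWithin_mono t fun s (hs : s ∈ Iio t) => ne_of_lt hs)
  have h3 : (W (u t)).toReal - (W v).toReal ≤ -(1 / 2 * (2 * inner ℝ (u t - v) (deriv u t))) := by
    refine ge_of_tendsto h2.neg ?_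
    filter_upwards [self_mem_nhdsWithin,
      mem_nhdsWithin_of_mem_nhds (Ioi_mem_nhds ht)] with s hs hs0
    have h4 := hevi s (le_of_lt hs0) hs v hv
    rw [slope_def_field]
    have h5 : -((1 / 2 * ‖u s - v‖ ^ 2 - 1 / 2 * ‖u t - v‖ ^ 2) / (s - t)) =
      (1 / 2 * ‖u s - v‖ ^ 2 - 1 / 2 * ‖u t - v‖ ^ 2) / (t - s) := by
      rw [← neg_sub t s, div_neg, neg_neg]
    rw [h5]
    linarith
  rw [inner_neg_left, ← inner_neg_right, neg_sub, real_inner_comm]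
  linarith

variable [CompleteSpace H]

theorem exists_isGradientFlow (hc : ConvexEnergy W) (hl : LowerSemicontinuous W) {x : H}
    (hx : x ∈ closure (effDomain W)) : ∃ u, IsGradientFlow W x u := by
  obtain ⟨v₀, hv₀⟩ : ∃ v, W v < ∞ := closure_nonempty_iff.1 ⟨x, hx⟩
  have hJ : ∀ l, 0 < l → ∀ x, IsProx W l x (prox W l x) :=
    fun l hpos x => isProx_prox hc hl ⟨v₀, hv₀⟩ hpos x
  have hlim : ∀ t : ℝ, ∃ y, 0 ≤ t → Tendsto (fun n => euler (prox W) n t x) atTop (𝓝 y) := by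
    intro t
    rcases le_or_gt 0 t with h | h
    · obtain ⟨y, hy⟩ := cauchySeq_tendsto_of_complete (cauchySeq_euler hJ hx h)
      exact ⟨y, fun _ => hy⟩
    · exact ⟨0, fun h' => absurd h' (not_le.2 h)⟩
  choose U hU using hlim
  have hU0 : U 0 = x := by
    refine tendsto_nhds_unique (hU 0 le_rfl) ?_
    simp only [euler_zero]
    exact tendsto_const_nhds
  -- Freezing the curve before time `a` makes it globally Lipschitz, as the differentiation lemmas
  -- require, and changes nothing after `a`.
  have hLip : ∀ a : ℝ, 0 < a → ∃ C : ℝ≥0, LipschitzWith C fun t => U (max t a) := by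
    intro a ha
    obtain ⟨C, hC0, hC⟩ := euler_limit_lipschitz hJ hU hv₀ ha
    have key : ∀ s t : ℝ, s ≤ t → dist (U (max t a)) (U (max s a)) ≤ C * dist t s := by
      intro s t hst
      have h1 := hC (max s a) (max t a) (le_max_right _ _) (max_le_max_right a hst)
      rw [dist_eq_norm, Real.dist_eq, abs_of_nonneg (by linarith)]
      refine h1.trans (mul_le_mul_of_nonneg_left ?_ hC0)
      have h2 := abs_max_sub_max_le_abs t s a
      rw [abs_of_nonneg (sub_nonneg.2 hst)] at h2
      exact (le_abs_self _).trans h2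
    refine ⟨⟨C, hC0⟩, LipschitzWith.of_dist_le_mul fun t s => ?_⟩
    rcases le_total s t with h | h
    · exact key s t h
    · rw [dist_comm, dist_comm t s]
      exact key t s h
  have hloc : ∀ a t : ℝ, a < t → (fun t => U (max t a)) =ᶠ[𝓝 t] U := by
    intro a t hat
    filter_upwards [Ioi_mem_nhds hat] with s hs
    rw [max_eq_left (le_of_lt hs)]
  have hderiv : ∀ a t : ℝ, a < t → deriv (fun t => U (max t a)) t = deriv U t :=
    fun a t hat => (hloc a t hat).deriv_eq
  have hevi := fun {s t : ℝ} (hs : 0 ≤ s) (hst : s < t) {v : H} (hv : W v < ∞) =>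
    euler_limit_energy_le hJ hl hU hs hst hv
  refine ⟨fun t => U t, ?_, by simpa using hU0, deriv U, ?_, ?_, ?_⟩
  · rw [continuous_iff_continuousAt]
    intro t
    rcases eq_zero_or_pos t with rfl | ht
    · rw [Metric.continuousAt_iff]
      intro ε hε
      obtain ⟨δ, hδ, h⟩ := euler_limit_tendsto_zero hJ hx hU (half_pos hε)
      refine ⟨δ, hδ, fun s hs => ?_⟩
      rw [NNReal.coe_zero, hU0, dist_eq_norm]
      rw [NNReal.dist_eq, NNReal.coe_zero, sub_zero, NNReal.abs_eq] at hs
      linarith [h s s.2 hs]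
    · have ht' : (0 : ℝ) < t := ht
      obtain ⟨C, hC⟩ := hLip (t / 2) (by positivity)
      have h1 : ContinuousAt U (t : ℝ) :=
        hC.continuous.continuousAt.congr (hloc _ _ (by linarith))
      exact ContinuousAt.comp (f := fun s : ℝ≥0 => (s : ℝ)) h1
        NNReal.continuous_coe.continuousAt
  · intro a b ha hab
    obtain ⟨C, hC⟩ := hLip (a / 2) (by positivity)
    have h1 : MemLp (deriv fun t => U (max t (a / 2))) 2 (volume.restrict (Icc a b)) :=
      MemLp.of_bound (stronglyMeasurable_deriv _).aestronglyMeasurable C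
        (Eventually.of_forall fun t => norm_deriv_le_of_lipschitz hC)
    refine h1.ae_eq ?_
    filter_upwards [ae_restrict_mem measurableSet_Icc] with t ht
    exact hderiv _ _ (by linarith [ht.1])
  · intro a b ha hab
    have ha' : (0 : ℝ) < a := ha
    have hab' : (a : ℝ) < b := hab
    obtain ⟨C, hC⟩ := hLip (a / 2) (by positivity)
    have h1 := LipschitzWith.integral_deriv_hilbert hC hab'.le
    rw [max_eq_left (by linarith), max_eq_left (by linarith)] at h1
    simp only [h1]
    refine intervalIntegral.integral_congr fun t ht => ?_
    rw [uIcc_of_le hab'.le] at ht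
    exact hderiv _ _ (by linarith [ht.1])
  · rw [ae_restrict_iff' measurableSet_Ioi]
    -- Countably many cut-off times `1 / (n + 1)` keep the exceptional set null.
    have h1 : ∀ n : ℕ, ∀ᵐ t : ℝ, DifferentiableAt ℝ (fun t => U (max t (1 / ((n : ℝ) + 1)))) t :=
      fun n => by
        obtain ⟨C, hC⟩ := hLip (1 / ((n : ℝ) + 1)) (by positivity)
        exact LipschitzWith.ae_differentiableAt_hilbert hC
    filter_upwards [ae_all_iff.2 h1] with t ht ht0
    have ht0' : 0 < t := ht0
    obtain ⟨n, hn⟩ := exists_nat_one_div_lt ht0'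
    have hd : DifferentiableAt ℝ U t := (ht n).congr_of_eventuallyEq (hloc _ _ hn).symm
    have e : ((t.toNNReal : ℝ≥0) : ℝ) = t := Real.coe_toNNReal t ht0'.le
    simp only [e]
    exact neg_deriv_mem_subgradient ht0' hd (hevi le_rfl ht0' hv₀).1
      fun s hs hst v hv => (hevi hs hst hv).2

end Existence

/-! ### Comparison of gradient flows -/

section Lyapunov

variable {H : Type*} [NormedAddCommGroup H] [InnerProductSpace ℝ H] [CompleteSpace H]

/-- `G` acts as the gradient of `‖G ·‖² / 2`, and `hψ` is the matching quadratic upper bound.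
Freezing `G (z r)` at `r = s` costs `ε ∫ ‖g‖`, counted twice, and the quadratic term costs it once
more. -/
theorem norm_sq_sub_le_of_near {z g : ℝ → H} {G : H → H} {s t ε : ℝ} (hst : s ≤ t)
    (hg : IntegrableOn g (Ioc s t)) (hz : z t - z s = ∫ r in s..t, g r)
    (hG : ∀ x y, ‖G x - G y‖ ≤ ‖x - y‖)
    (hψ : ∀ x y, ‖G y‖ ^ 2 ≤ ‖G x‖ ^ 2 + 2 * inner ℝ (G x) (y - x) + ‖y - x‖ ^ 2)
    (hle : ∀ᵐ r ∂volume.restrict (Ioc s t), inner ℝ (G (z r)) (g r) ≤ 0)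
    (hε : ∀ r ∈ Icc s t, ‖z r - z s‖ ≤ ε) :
    ‖G (z t)‖ ^ 2 - ‖G (z s)‖ ^ 2 ≤ 3 * ε * ∫ r in s..t, ‖g r‖ := by
  have hz' : z t - z s = ∫ r in Ioc s t, g r := by
    rw [hz, intervalIntegral.integral_of_le hst]
  rw [intervalIntegral.integral_of_le hst]
  have hε0 : 0 ≤ ε := (norm_nonneg _).trans (hε s (left_mem_Icc.2 hst))
  have h1 : ‖z t - z s‖ ^ 2 ≤ ε * ∫ r in Ioc s t, ‖g r‖ := by
    rw [sq]
    refine mul_le_mul (hε t (right_mem_Icc.2 hst)) ?_ (norm_nonneg _) hε0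
    rw [hz']
    exact norm_integral_le_integral_norm _
  have h2 : inner ℝ (G (z s)) (z t - z s) ≤ ε * ∫ r in Ioc s t, ‖g r‖ := by
    rw [hz', ← integral_inner hg, ← integral_const_mul]
    refine integral_mono_ae (hg.const_inner _) (hg.norm.const_mul _) ?_
    filter_upwards [hle, ae_restrict_mem measurableSet_Ioc] with r hr hrm
    have h3 : inner ℝ (G (z s)) (g r) = inner ℝ (G (z r)) (g r)
        + inner ℝ (G (z s) - G (z r)) (g r) := by rw [inner_sub_left]; ring
    have h4 := real_inner_le_norm (G (z s) - G (z r)) (g r)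
    have h5 : ‖G (z s) - G (z r)‖ ≤ ε := by
      refine (hG _ _).trans ?_
      rw [norm_sub_rev]
      exact hε r (Ioc_subset_Icc_self hrm)
    have h6 := mul_le_mul_of_nonneg_right h5 (norm_nonneg (g r))
    linarith
  have := hψ (z s) (z t)
  linarith

/-- A monotonicity statement without a chain rule: the short-interval errors add up to `3 ε ∫ ‖g‖`,
and `ε` is arbitrary. -/
theorem norm_sq_le_of_inner_nonpos {z g : ℝ → H} {G : H → H} {a b : ℝ} (hab : a ≤ b)
    (hg : IntegrableOn g (Ioc a b)) (hzc : ContinuousOn z (Icc a b))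
    (hz : ∀ s t, a ≤ s → s ≤ t → t ≤ b → z t - z s = ∫ r in s..t, g r)
    (hG : ∀ x y, ‖G x - G y‖ ≤ ‖x - y‖)
    (hψ : ∀ x y, ‖G y‖ ^ 2 ≤ ‖G x‖ ^ 2 + 2 * inner ℝ (G x) (y - x) + ‖y - x‖ ^ 2)
    (hle : ∀ᵐ r ∂volume.restrict (Ioc a b), inner ℝ (G (z r)) (g r) ≤ 0) :
    ‖G (z b)‖ ^ 2 ≤ ‖G (z a)‖ ^ 2 := by
  have key : ∀ ε > 0, ‖G (z b)‖ ^ 2 - ‖G (z a)‖ ^ 2 ≤ 3 * ε * ∫ r in a..b, ‖g r‖ := by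
    intro ε hε
    have huc := isCompact_Icc.uniformContinuousOn_of_continuous hzc
    rw [Metric.uniformContinuousOn_iff] at huc
    obtain ⟨δ, hδ, hδz⟩ := huc ε hε
    have hint : ∀ s t, a ≤ s → s ≤ t → t ≤ b → IntervalIntegrable (fun r => ‖g r‖) volume s t :=
      fun s t has hst htb => (intervalIntegrable_iff_integrableOn_Ioc_of_le hst).2
        (hg.mono_set (Ioc_subset_Ioc has htb)).norm
    have hstep : ∀ s t, a ≤ s → s ≤ t → t ≤ b → t ≤ s + δ / 2 →
        ‖G (z t)‖ ^ 2 - ‖G (z s)‖ ^ 2 ≤ 3 * ε * ∫ r in s..t, ‖g r‖ := by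
      intro s t has hst htb hδ'
      have hsub : Ioc s t ⊆ Ioc a b := Ioc_subset_Ioc has htb
      refine norm_sq_sub_le_of_near hst (hg.mono_set hsub) (hz s t has hst htb) hG hψ
        (ae_restrict_of_ae_restrict_of_subset hsub hle) fun r hr => ?_
      rw [← dist_eq_norm]
      refine (hδz r ⟨has.trans hr.1, hr.2.trans htb⟩ s ⟨has, hst.trans htb⟩ ?_).le
      rw [Real.dist_eq, abs_of_nonneg (sub_nonneg.2 hr.1)]
      linarith [hr.2]
    have hind : ∀ n : ℕ, ∀ t, a ≤ t → t ≤ b → t ≤ a + n * (δ / 2) →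
        ‖G (z t)‖ ^ 2 - ‖G (z a)‖ ^ 2 ≤ 3 * ε * ∫ r in a..t, ‖g r‖ := by
      intro n
      induction n with
      | zero =>
        intro t hat _ ht
        have : t = a := le_antisymm (by simpa using ht) hat
        subst this
        simp
      | succ n ih =>
        intro t hat htb ht
        push_cast at ht
        have hm1 : a ≤ max a (t - δ / 2) := le_max_left _ _
        have hm2 : max a (t - δ / 2) ≤ t := max_le hat (by linarith)
        have h1 := ih (max a (t - δ / 2)) hm1 (hm2.trans htb)
          (max_le (by have : (0 : ℝ) ≤ n * (δ / 2) := by positivity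
                      linarith) (by linarith))
        have h2 := hstep (max a (t - δ / 2)) t hm1 hm2 htb (by linarith [le_max_right a (t - δ / 2)])
        rw [← intervalIntegral.integral_add_adjacent_intervals (hint a _ le_rfl hm1 (hm2.trans htb))
          (hint _ t hm1 hm2 htb)]
        linarith
    obtain ⟨n, hn⟩ := exists_nat_gt ((b - a) / (δ / 2))
    rw [div_lt_iff₀ (by positivity)] at hn
    exact hind n b hab le_rfl (by linarith)
  have hlim : Tendsto (fun n : ℕ => 3 * (1 / ((n : ℝ) + 1)) * ∫ r in a..b, ‖g r‖) atTop
      (𝓝 (3 * 0 * ∫ r in a..b, ‖g r‖)) :=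
    (tendsto_one_div_succ.const_mul 3).mul_const _
  have := ge_of_tendsto' hlim fun n => key _ (show 0 < 1 / ((n : ℝ) + 1) by positivity)
  linarith

end Lyapunov

/-! ### The truncation criterion for comparison in `L²` -/

section Comparison

variable {X : Type*} [MeasurableSpace X] {μ : Measure X}

/-- Pointwise, `(y - k)⁺ ≤ |(x - k)⁺ + (y - x)|`; the right side of the claim is the expanded
squared norm. -/
theorem norm_posPart_sub_sq_le (k x y : Lp ℝ 2 μ) :
    ‖(y - k) ⊔ 0‖ ^ 2 ≤ ‖(x - k) ⊔ 0‖ ^ 2 + 2 * inner ℝ ((x - k) ⊔ 0) (y - x) + ‖y - x‖ ^ 2 := by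
  rw [← norm_add_sq_real]
  gcongr
  apply norm_le_norm_of_abs_le_abs
  rw [abs_of_nonneg (a := (y - k) ⊔ 0) le_sup_right]
  refine sup_le ?_ (abs_nonneg _)
  calc y - k = (x - k) + (y - x) := by abel
    _ ≤ (x - k) ⊔ 0 + (y - x) := by gcongr; exact le_sup_left
    _ ≤ _ := le_abs_self _

/-- Test `f` at `u - w` and `g` at `v + w` and add; the energies cancel by `h`. -/
theorem inner_posPart_nonneg_of_subgradient {H : Type*} [NormedAddCommGroup H]
    [InnerProductSpace ℝ H] {W₁ W₂ : H → ℝ≥0∞} {u v f g w : H}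
    (hf : f ∈ subgradient W₁ u) (hg : g ∈ subgradient W₂ v)
    (h : W₁ (u - w) + W₂ (v + w) ≤ W₁ u + W₂ v) : 0 ≤ inner ℝ w (f - g) := by
  rw [mem_subgradient_iff] at hf hg
  have hfin : W₁ u + W₂ v < ∞ := ENNReal.add_lt_top.2 ⟨hf.1, hg.1⟩
  obtain ⟨h1, h2⟩ := ENNReal.add_lt_top.1 (h.trans_lt hfin)
  have h3 := ENNReal.toReal_mono hfin.ne h
  rw [ENNReal.toReal_add h1.ne h2.ne, ENNReal.toReal_add hf.1.ne hg.1.ne] at h3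
  have h4 := hf.2 _ h1
  have h5 := hg.2 _ h2
  rw [sub_sub_cancel_left, inner_neg_right] at h4
  rw [add_sub_cancel_left] at h5
  rw [real_inner_comm, inner_sub_left]
  linarith

/-- Gradient flows stay comparable if truncation decreases the sum of the energies. -/
theorem sub_le_of_isGradientFlow {W₁ W₂ : Lp ℝ 2 μ → ℝ≥0∞} {u₀ v₀ k : Lp ℝ 2 μ}
    {u v : ℝ≥0 → Lp ℝ 2 μ} (hu : IsGradientFlow W₁ u₀ u) (hv : IsGradientFlow W₂ v₀ v)
    (h : ∀ t, W₁ (u t - ((u t - v t - k) ⊔ 0)) + W₂ (v t + ((u t - v t - k) ⊔ 0)) ≤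
      W₁ (u t) + W₂ (v t)) (h0 : u₀ - v₀ ≤ k) (t : ℝ≥0) : u t - v t ≤ k := by
  obtain ⟨hu1, hu2, f, hf1, hf2, hf3⟩ := hu
  obtain ⟨hv1, hv2, g, hg1, hg2, hg3⟩ := hv
  set G : Lp ℝ 2 μ → Lp ℝ 2 μ := fun x => (x - k) ⊔ 0 with hG
  have hGlip : ∀ x y, ‖G x - G y‖ ≤ ‖x - y‖ := fun x y => by
    refine (norm_sup_sub_sup_le_norm _ _ _).trans_eq ?_
    rw [sub_sub_sub_cancel_right]
  have hGc : Continuous G := by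
    refine LipschitzWith.continuous (K := 1) (LipschitzWith.of_dist_le_mul fun x y => ?_)
    rw [dist_eq_norm, dist_eq_norm, NNReal.coe_one, one_mul]
    exact hGlip x y
  -- The derivatives are integrable only away from time zero, so the initial time is reached
  -- afterwards by continuity.
  have hmono : ∀ a b : ℝ≥0, 0 < a → a ≤ b → ‖G (u b - v b)‖ ^ 2 ≤ ‖G (u a - v a)‖ ^ 2 := by
    intro a b ha hab
    have ha' : (0 : ℝ) < a := ha
    have hab' : (a : ℝ) ≤ b := hab
    have hint : ∀ {φ : ℝ → Lp ℝ 2 μ},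
        (∀ a b : ℝ, 0 < a → a < b → MemLp φ 2 (volume.restrict (Icc a b))) →
        ∀ s t : ℝ, 0 < s → IntegrableOn φ (Ioc s t) := by
      intro φ hφ s t hs
      have h1 : IntegrableOn φ (Icc s (max t (s + 1))) :=
        (hφ s (max t (s + 1)) hs (lt_max_of_lt_right (by linarith))).integrable (by norm_num)
      exact h1.mono_set (Ioc_subset_Icc_self.trans (Icc_subset_Icc_right (le_max_left _ _)))
    have hprim : ∀ {w : ℝ≥0 → Lp ℝ 2 μ} {φ : ℝ → Lp ℝ 2 μ},
        (∀ a b : ℝ≥0, 0 < a → a < b → w b - w a = ∫ t in (a : ℝ)..(b : ℝ), φ t) →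
        ∀ s t : ℝ, 0 < s → s ≤ t → w t.toNNReal - w s.toNNReal = ∫ r in s..t, φ r := by
      intro w φ hw s t hs hst
      rcases hst.eq_or_lt with rfl | hst
      · simp
      · have := hw s.toNNReal t.toNNReal (by simpa using hs)
          ((Real.toNNReal_lt_toNNReal_iff (hs.trans hst)).2 hst)
        rwa [Real.coe_toNNReal s hs.le, Real.coe_toNNReal t (hs.trans hst).le] at this
    have key := norm_sq_le_of_inner_nonpos (z := fun t => u t.toNNReal - v t.toNNReal)
      (g := fun t => f t - g t) (G := G) hab'
      ((hint hf1 a b ha').sub (hint hg1 a b ha'))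
      (Continuous.continuousOn (by fun_prop)) ?_ hGlip ?_ ?_
    · simpa using key
    · intro s t has hst htb
      have hs : 0 < s := ha'.trans_le has
      have ii : ∀ {φ : ℝ → Lp ℝ 2 μ},
        (∀ a b : ℝ, 0 < a → a < b → MemLp φ 2 (volume.restrict (Icc a b))) →
          IntervalIntegrable φ volume s t := fun hφ =>
        (intervalIntegrable_iff_integrableOn_Ioc_of_le hst).2 (hint hφ s t hs)
      rw [intervalIntegral.integral_sub (ii hf1) (ii hg1), ← hprim hf2 s t hs hst,
        ← hprim hg2 s t hs hst]
      abel
    · exact norm_posPart_sub_sq_le k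
    · have hsub : Ioc (a : ℝ) b ⊆ Ioi 0 := fun r hr => ha'.trans hr.1
      filter_upwards [ae_restrict_of_ae_restrict_of_subset hsub hf3,
        ae_restrict_of_ae_restrict_of_subset hsub hg3] with r hr1 hr2
      have h1 := inner_posPart_nonneg_of_subgradient hr1 hr2 (h r.toNNReal)
      rw [← neg_add', inner_neg_right, ← sub_eq_add_neg] at h1
      simp only [hG]
      linarith
  have hcont : Continuous fun s => ‖G (u s - v s)‖ ^ 2 := by fun_prop
  have hzero : ‖G (u t - v t)‖ ^ 2 ≤ 0 := by
    rcases eq_zero_or_pos t with rfl | ht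
    · rw [hu2, hv2, hG]
      simp only
      rw [sup_eq_right.2 (sub_nonpos.2 h0)]
      simp
    · have h1 : Tendsto (fun n : ℕ => t * (1 / ((n : ℝ≥0) + 1))) atTop (𝓝 (t * 0)) := by
        refine Tendsto.const_mul _ ?_
        rw [← NNReal.tendsto_coe]
        simpa using tendsto_one_div_succ
      rw [mul_zero] at h1
      have h2 := (hcont.tendsto 0).comp h1
      have h3 : ‖G (u 0 - v 0)‖ ^ 2 = 0 := by
        rw [hu2, hv2, hG]
        simp only
        rw [sup_eq_right.2 (sub_nonpos.2 h0)]
        simp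
      rw [h3] at h2
      refine ge_of_tendsto' h2 fun n => hmono _ t (by positivity) ?_
      refine mul_le_of_le_one_right' ?_
      rw [div_le_one (by positivity)]
      exact le_add_of_nonneg_left (by positivity)
  have hG0 : G (u t - v t) = 0 := by
    have := pow_eq_zero_iff (two_ne_zero) |>.1 (le_antisymm hzero (sq_nonneg _))
    exact norm_eq_zero.1 this
  exact sub_nonpos.1 (sup_eq_right.1 hG0)

end Comparison

end ConvexFlow

namespace Gasket

/-! ### Barycentric coordinates and the cell structure of the gasket -/

section Geometry

variable {N : ℕ} {p : Fin N → Space N}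

/-- The barycentric coordinates with respect to a regular simplex with edges of length one; the
quadratic terms cancel. -/
def bary (p : Fin N → Space N) (i : Fin N) (x : Space N) : ℝ :=
  1 / N + 1 / N * ∑ k, ‖x - p k‖ ^ 2 - ‖x - p i‖ ^ 2

theorem continuous_bary (i : Fin N) : Continuous (bary p i) := by
  unfold bary
  fun_prop

/-- The midpoint correction `-‖x - p i‖² / 4` does not depend on the vertex `p j`, so it cancels
between the mean and the `j`-th term. -/
theorem bary_simMap (hN : 2 ≤ N) (i j : Fin N) (x : Space N) :
    bary p j (simMap p i x) = 1 / 2 * bary p j x + 1 / 2 * bary p j (p i) := by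
  have hN' : (N : ℝ) ≠ 0 := by positivity
  unfold bary simMap
  simp only [ConvexFlow.norm_midpoint_sub_sq, Finset.sum_sub_distrib, Finset.sum_add_distrib,
    ← Finset.mul_sum, Finset.sum_const, Finset.card_univ, Fintype.card_fin, nsmul_eq_mul]
  field_simp
  ring

theorem bary_vertex (hN : 2 ≤ N) (hp : ∀ i j, i ≠ j → dist (p i) (p j) = 1) (i j : Fin N) :
    bary p i (p j) = if i = j then 1 else 0 := by
  have hN' : (N : ℝ) ≠ 0 := by positivity
  have h1 : ∀ k, ‖p j - p k‖ ^ 2 = 1 - if j = k then 1 else 0 := by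
    intro k
    split_ifs with h
    · simp [h]
    · rw [← dist_eq_norm, hp j k h]; norm_num
  simp only [bary, h1, Finset.sum_sub_distrib, Finset.sum_ite_eq, Finset.mem_univ, if_true,
    Finset.sum_const, Finset.card_univ, Fintype.card_fin, nsmul_eq_mul, mul_one]
  rcases eq_or_ne i j with rfl | h
  · simp; field_simp; ring
  · rw [if_neg h, if_neg h.symm]; field_simp; ring

theorem sum_bary (hN : 2 ≤ N) (x : Space N) : ∑ i, bary p i x = 1 := by
  have hN' : (N : ℝ) ≠ 0 := by positivity
  simp only [bary, Finset.sum_sub_distrib, Finset.sum_const, Finset.card_univ, Fintype.card_fin,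
    nsmul_eq_mul]
  field_simp
  ring

/-- A closed set that contains the vertices and is mapped into itself by the similarities contains
the gasket. -/
theorem gasket_subset {K : Set (Space N)} (hK : IsClosed K) (h0 : ∀ i, p i ∈ K)
    (hs : ∀ i, ∀ x ∈ K, simMap p i x ∈ K) : gasket p ⊆ K := by
  refine closure_minimal (iUnion_subset fun m => ?_) hK
  induction m with
  | zero => rintro _ ⟨i, rfl⟩; exact h0 i
  | succ m ih =>
    refine iUnion_subset fun i => ?_
    rintro _ ⟨x, hx, rfl⟩
    exact hs i x (ih hx)

theorem bary_nonneg (hN : 2 ≤ N) (hp : ∀ i j, i ≠ j → dist (p i) (p j) = 1) {x : Space N}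
    (hx : x ∈ gasket p) (i : Fin N) : 0 ≤ bary p i x := by
  have hv : ∀ j, 0 ≤ bary p i (p j) := fun j => by
    rw [bary_vertex hN hp]; split_ifs <;> norm_num
  refine gasket_subset (K := {x | 0 ≤ bary p i x})
    (isClosed_le continuous_const (continuous_bary i)) hv (fun j y hy => ?_) hx
  have hy' : 0 ≤ bary p i y := hy
  have := hv j
  rw [mem_ofPred_eq, bary_simMap hN]
  positivity

/-- The identity holds at the vertices and passes through each similarity, so minimality of the
gasket gives it everywhere on `V`. -/
theorem eq_sum_bary (hN : 2 ≤ N) (hp : ∀ i j, i ≠ j → dist (p i) (p j) = 1) {x : Space N}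
    (hx : x ∈ gasket p) : x = ∑ i, bary p i x • p i := by
  have hv : ∀ j, p j = ∑ i, bary p i (p j) • p i := fun j => by
    simp [bary_vertex hN hp]
  refine gasket_subset (K := {x | x = ∑ i, bary p i x • p i})
    (isClosed_eq continuous_id (continuous_finsetSum _ fun i _ =>
      (continuous_bary i).smul continuous_const)) hv (fun j y hy => ?_) hx
  have hy' : y = ∑ i, bary p i y • p i := hy
  simp only [mem_ofPred_eq, bary_simMap hN, add_smul, Finset.sum_add_distrib, mul_smul,
    ← Finset.smul_sum]
  rw [← hy', ← hv j, simMap]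

theorem continuous_simMap (i : Fin N) : Continuous (simMap p i) := by
  unfold simMap
  fun_prop

theorem simMap_injective (i : Fin N) : Function.Injective (simMap p i) := by
  intro x y h
  unfold simMap at h
  have := add_right_cancel h
  exact smul_right_injective _ (by norm_num : (1 / 2 : ℝ) ≠ 0) this

theorem simMap_vertex_self (i : Fin N) : simMap p i (p i) = p i := by
  unfold simMap
  module

theorem simMap_vertex_comm (i j : Fin N) : simMap p i (p j) = simMap p j (p i) := by
  unfold simMap
  exact add_comm _ _

theorem simMap_mem {x : Space N} (hx : x ∈ gasket p) (i : Fin N) : simMap p i x ∈ gasket p := by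
  have h : MapsTo (simMap p i) (⋃ m, vertexSet p m) (⋃ m, vertexSet p m) := by
    intro y hy
    obtain ⟨m, hm⟩ := mem_iUnion.1 hy
    exact mem_iUnion.2 ⟨m + 1, mem_iUnion.2 ⟨i, y, hm, rfl⟩⟩
  exact h.closure (continuous_simMap i) hx

theorem isCompact_gasket (hN : 2 ≤ N) (hp : ∀ i j, i ≠ j → dist (p i) (p j) = 1) :
    IsCompact (gasket p) := by
  refine Metric.isCompact_of_isClosed_isBounded isClosed_closure ?_
  refine isBounded_iff_forall_norm_le.2 ⟨∑ i, ‖p i‖, fun x hx => ?_⟩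
  rw [eq_sum_bary hN hp hx]
  refine (norm_sum_le _ _).trans (Finset.sum_le_sum fun i _ => ?_)
  have h0 := fun j => bary_nonneg hN hp hx j
  have h1 : bary p i x ≤ 1 := by
    rw [← sum_bary (p := p) hN x]
    exact Finset.single_le_sum (fun j _ => h0 j) (Finset.mem_univ i)
  rw [norm_smul, Real.norm_of_nonneg (h0 i)]
  exact mul_le_of_le_one_left (norm_nonneg _) h1

theorem exists_simMap_eq (hN : 2 ≤ N) (hp : ∀ i j, i ≠ j → dist (p i) (p j) = 1) {x : Space N}
    (hx : x ∈ gasket p) : ∃ i, ∃ y ∈ gasket p, simMap p i y = x := by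
  have hcl : IsClosed (⋃ i, simMap p i '' gasket p) :=
    isClosed_iUnion_of_finite fun i =>
      ((isCompact_gasket hN hp).image (continuous_simMap i)).isClosed
  have hsub := gasket_subset hcl
    (fun i => mem_iUnion.2 ⟨i, p i, (bdry p i).2, simMap_vertex_self i⟩)
    (fun i x hx => mem_iUnion.2 ⟨i, x, by
      obtain ⟨j, y, hy, rfl⟩ := mem_iUnion.1 hx
      exact simMap_mem hy j, rfl⟩)
  obtain ⟨i, y, hy, h⟩ := mem_iUnion.1 (hsub hx)
  exact ⟨i, y, hy, h⟩

/-- Distinct cells of level one meet in a single point. -/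
theorem simMap_eq_simMap (hN : 2 ≤ N) (hp : ∀ i j, i ≠ j → dist (p i) (p j) = 1)
    {x y : Space N} (hx : x ∈ gasket p) (hy : y ∈ gasket p) {i j : Fin N} (hij : i ≠ j)
    (h : simMap p i x = simMap p j y) : x = p j ∧ y = p i := by
  have key : ∀ {x y : Space N}, x ∈ gasket p → y ∈ gasket p → ∀ {i j : Fin N}, i ≠ j →
      simMap p i x = simMap p j y → x = p j := by
    intro x y hx hy i j hij h
    -- The `j`-th coordinate gives `bary p j x = bary p j y + 1 ≥ 1`; as the coordinates are
    -- nonnegative with sum one, all others vanish.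
    have h1 : bary p j (simMap p i x) = bary p j (simMap p j y) := by rw [h]
    rw [bary_simMap hN, bary_simMap hN, bary_vertex hN hp, bary_vertex hN hp, if_neg hij.symm,
      if_pos rfl] at h1
    have hy0 := bary_nonneg hN hp hy j
    have hxs := sum_bary (p := p) hN x
    rw [← Finset.add_sum_erase _ _ (Finset.mem_univ j)] at hxs
    have hx0 : ∀ k ∈ Finset.univ.erase j, 0 ≤ bary p k x := fun k _ => bary_nonneg hN hp hx k
    have hsum0 : ∑ k ∈ Finset.univ.erase j, bary p k x = 0 :=
      le_antisymm (by linarith) (Finset.sum_nonneg hx0)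
    have hz := (Finset.sum_eq_zero_iff_of_nonneg hx0).1 hsum0
    rw [eq_sum_bary hN hp hx, ← Finset.add_sum_erase _ _ (Finset.mem_univ j),
      Finset.sum_eq_zero fun k hk => by rw [hz k hk, zero_smul], add_zero]
    have : bary p j x = 1 := by linarith
    rw [this, one_smul]
  exact ⟨key hx hy hij h, key hy hx hij.symm h.symm⟩

theorem vertex_mem_vertexSet (i : Fin N) (m : ℕ) : p i ∈ vertexSet p m := by
  induction m with
  | zero => exact ⟨i, rfl⟩
  | succ m ih => exact mem_iUnion.2 ⟨i, p i, ih, simMap_vertex_self i⟩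

/-- If the vertex comes from another cell `j`, then `x` is the contact point `p j`, which lies in
every `V_m`. -/
theorem mem_vertexSet_of_simMap_mem (hN : 2 ≤ N) (hp : ∀ i j, i ≠ j → dist (p i) (p j) = 1)
    {x : Space N} (hx : x ∈ gasket p) {i : Fin N} {m : ℕ}
    (h : simMap p i x ∈ vertexSet p (m + 1)) : x ∈ vertexSet p m := by
  obtain ⟨j, y, hy, hyx⟩ := mem_iUnion.1 h
  rcases eq_or_ne i j with rfl | hij
  · rwa [← simMap_injective i hyx]
  · rw [(simMap_eq_simMap hN hp hx (vertexSet_subset_gasket p m hy) hij hyx.symm).1]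
    exact vertex_mem_vertexSet j m

/-- The similarity `F_i`, as a map of the gasket into itself. -/
def cellMap (p : Fin N → Space N) (i : Fin N) (x : gasket p) : gasket p :=
  ⟨simMap p i x, simMap_mem x.2 i⟩

theorem continuous_cellMap (i : Fin N) : Continuous (cellMap p i) :=
  ((continuous_simMap i).comp continuous_subtype_val).subtype_mk _

theorem cellMap_injective (i : Fin N) : Function.Injective (cellMap p i) := by
  intro x y h
  exact Subtype.ext (simMap_injective i (congrArg Subtype.val h))

theorem cellMap_bdry_self (i : Fin N) : cellMap p i (bdry p i) = bdry p i :=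
  Subtype.ext (simMap_vertex_self i)

theorem cellMap_bdry_comm (i j : Fin N) : cellMap p i (bdry p j) = cellMap p j (bdry p i) :=
  Subtype.ext (simMap_vertex_comm i j)

theorem bdry_injective (hp : ∀ i j, i ≠ j → dist (p i) (p j) = 1) :
    Function.Injective (bdry p) := by
  intro i j h
  by_contra hij
  have h1 := hp i j hij
  have h2 : p i = p j := congrArg Subtype.val h
  simp [h2] at h1

theorem cellMap_eq_cellMap (hN : 2 ≤ N) (hp : ∀ i j, i ≠ j → dist (p i) (p j) = 1)
    {x y : gasket p} {i j : Fin N} (hij : i ≠ j) (h : cellMap p i x = cellMap p j y) :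
    x = bdry p j ∧ y = bdry p i := by
  have := simMap_eq_simMap hN hp x.2 y.2 hij (congrArg Subtype.val h)
  exact ⟨Subtype.ext this.1, Subtype.ext this.2⟩

theorem exists_cellMap_eq (hN : 2 ≤ N) (hp : ∀ i j, i ≠ j → dist (p i) (p j) = 1)
    (x : gasket p) : ∃ i y, cellMap p i y = x := by
  obtain ⟨i, y, hy, h⟩ := exists_simMap_eq hN hp x.2
  exact ⟨i, ⟨y, hy⟩, Subtype.ext h⟩

theorem cellMap_mem_vertices (hN : 2 ≤ N) (hp : ∀ i j, i ≠ j → dist (p i) (p j) = 1)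
    {m : ℕ} {i : Fin N} {x : gasket p} :
    cellMap p i x ∈ vertices p (m + 1) ↔ x ∈ vertices p m := by
  rw [mem_vertices, mem_vertices]
  exact ⟨fun h => mem_vertexSet_of_simMap_mem hN hp x.2 h,
    fun h => mem_iUnion.2 ⟨i, x, h, rfl⟩⟩

theorem vertices_zero [DecidableEq (gasket p)] : vertices p 0 = Finset.univ.image (bdry p) := by
  ext x
  rw [mem_vertices]
  simp only [Finset.mem_image, Finset.mem_univ, true_and]
  constructor
  · rintro ⟨i, hi⟩
    exact ⟨i, Subtype.ext hi⟩
  · rintro ⟨i, rfl⟩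
    exact ⟨i, rfl⟩

theorem sameCell_zero (x y : gasket p) : SameCell p 0 x y :=
  ⟨[], rfl, ⟨x, x.2, rfl⟩, ⟨y, y.2, rfl⟩⟩

theorem wordMap_mem {x : Space N} (hx : x ∈ gasket p) (w : List (Fin N)) :
    wordMap p w x ∈ gasket p := by
  induction w with
  | nil => exact hx
  | cons i w ih => exact simMap_mem ih i

theorem sameCell_succ_iff {m : ℕ} {x y : gasket p} :
    SameCell p (m + 1) x y ↔
      ∃ i x' y', SameCell p m x' y' ∧ cellMap p i x' = x ∧ cellMap p i y' = y := by
  constructor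
  · rintro ⟨w, hw, ⟨a, ha, hax⟩, ⟨b, hb, hby⟩⟩
    obtain ⟨i, w, rfl⟩ := List.exists_cons_of_length_eq_add_one hw
    refine ⟨i, ⟨wordMap p w a, wordMap_mem ha w⟩, ⟨wordMap p w b, wordMap_mem hb w⟩,
      ⟨w, by simpa using hw, ⟨a, ha, rfl⟩, ⟨b, hb, rfl⟩⟩, Subtype.ext hax, Subtype.ext hby⟩
  · rintro ⟨i, x', y', ⟨w, hw, ⟨a, ha, hax⟩, ⟨b, hb, hby⟩⟩, rfl, rfl⟩
    refine ⟨i :: w, by simp [hw], ⟨a, ha, ?_⟩, ⟨b, hb, ?_⟩⟩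
    · rw [wordMap, Function.comp_apply, hax]; rfl
    · rw [wordMap, Function.comp_apply, hby]; rfl

end Geometry

/-! ### The energy of the simplex and of its first subdivision -/

section Simplex

variable {N : ℕ}

theorem sum_sum_sub_mul_sub (a b : Fin N → ℝ) :
    ∑ j, ∑ k, (a j - a k) * (b j - b k) =
      2 * (N * ∑ j, a j * b j - (∑ j, a j) * ∑ j, b j) := by
  have e : ∀ j k, (a j - a k) * (b j - b k) = a j * b j + a k * b k - a j * b k - a k * b j :=
    fun j k => by ring
  simp only [e, Finset.sum_sub_distrib, Finset.sum_add_distrib, Finset.sum_const, Finset.card_univ,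
    Fintype.card_fin, nsmul_eq_mul, ← Finset.mul_sum, ← Finset.sum_mul]
  ring

/-- The harmonic extension of the values `c` at the vertices of the simplex: its value at the
midpoint of `p_i` and `p_j`, or at `p_i` if `i = j`. -/
def harmonicExt (c : Fin N → ℝ) (i j : Fin N) : ℝ :=
  (c i + c j + ∑ k, c k + if i = j then N * c i - ∑ k, c k else 0) / (N + 2)

theorem harmonicExt_comm (c : Fin N → ℝ) (i j : Fin N) : harmonicExt c i j = harmonicExt c j i := by
  rcases eq_or_ne i j with rfl | h
  · rfl
  · simp only [harmonicExt, if_neg h, if_neg h.symm]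
    ring

theorem harmonicExt_self (c : Fin N → ℝ) (i : Fin N) : harmonicExt c i i = c i := by
  have : (N : ℝ) + 2 ≠ 0 := by positivity
  simp only [harmonicExt, if_true]
  field_simp
  ring

theorem sum_harmonicExt (c : Fin N → ℝ) (i : Fin N) :
    ∑ j, harmonicExt c i j = N * (2 * c i + ∑ k, c k) / (N + 2) := by
  simp only [harmonicExt, ← Finset.sum_div, Finset.sum_add_distrib, Finset.sum_ite_eq,
    Finset.mem_univ, if_true, Finset.sum_const, Finset.card_univ, Fintype.card_fin, nsmul_eq_mul]
  ring

/-- The energy product of a harmonic extension and any function depends on the boundary values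
only. -/
theorem sum_harmonicExt_mul {c : Fin N → ℝ} {x : Fin N → Fin N → ℝ}
    (hx : ∀ i j, x i j = x j i) (hd : ∀ i, x i i = c i) :
    ∑ i, ∑ j, ∑ k, (harmonicExt c i j - harmonicExt c i k) * (x i j - x i k) =
      N / (N + 2) * ∑ i, ∑ j, (c i - c j) ^ 2 := by
  have hN : (N : ℝ) + 2 ≠ 0 := by positivity
  have h1 : ∀ i, ∑ j, ∑ k, (harmonicExt c i j - harmonicExt c i k) * (x i j - x i k) =
      2 * (N / (N + 2)) * (∑ j, (c j - c i) * x i j + (N * c i - ∑ k, c k) * c i) := by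
    intro i
    have h2 : (N * c i - ∑ k, c k) * c i =
        ∑ j, (if i = j then N * c i - ∑ k, c k else 0) * x i j := by
      simp [ite_mul, hd]
    rw [sum_sum_sub_mul_sub, sum_harmonicExt, h2, ← Finset.sum_add_distrib, Finset.mul_sum,
      Finset.mul_sum, ← Finset.sum_sub_distrib, Finset.mul_sum, Finset.mul_sum]
    refine Finset.sum_congr rfl fun j _ => ?_
    simp only [harmonicExt]
    field_simp
    ring
  -- An antisymmetric coefficient is paired with the symmetric `x`.
  have h3 : ∑ i, ∑ j, (c j - c i) * x i j = 0 := by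
    have h4 : ∑ i, ∑ j, (c j - c i) * x i j = -∑ i, ∑ j, (c j - c i) * x i j := by
      conv_lhs => rw [Finset.sum_comm]
      simp only [← Finset.sum_neg_distrib]
      refine Finset.sum_congr rfl fun i _ => Finset.sum_congr rfl fun j _ => ?_
      rw [hx j i]
      ring
    linarith
  have h5 : ∑ i, ∑ j, (c i - c j) ^ 2 = 2 * ∑ i, (N * c i - ∑ k, c k) * c i := by
    simp only [sq]
    rw [sum_sum_sub_mul_sub]
    simp only [sub_mul, Finset.sum_sub_distrib, mul_assoc, ← Finset.mul_sum]
  rw [Finset.sum_congr rfl fun i _ => h1 i, ← Finset.mul_sum, Finset.sum_add_distrib, h3, h5]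
  ring

theorem sum_harmonicExt_sq (c : Fin N → ℝ) :
    ∑ i, ∑ j, ∑ k, (harmonicExt c i j - harmonicExt c i k) ^ 2 =
      N / (N + 2) * ∑ i, ∑ j, (c i - c j) ^ 2 := by
  simp only [sq (harmonicExt c _ _ - harmonicExt c _ _)]
  exact sum_harmonicExt_mul (harmonicExt_comm c) (harmonicExt_self c)

/-- Harmonic extensions minimise the energy. -/
theorem simplex_energy_le {x : Fin N → Fin N → ℝ} (hx : ∀ i j, x i j = x j i) :
    N / (N + 2) * ∑ i, ∑ j, (x i i - x j j) ^ 2 ≤ ∑ i, ∑ j, ∑ k, (x i j - x i k) ^ 2 := by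
  set h := harmonicExt fun i => x i i with hh
  -- Expand the energy of `x - h`: the mixed product equals the energy of `h`, so the energy of `x`
  -- is at least that of `h`.
  have h1 : 0 ≤ ∑ i, ∑ j, ∑ k, ((x i j - h i j) - (x i k - h i k)) ^ 2 :=
    Finset.sum_nonneg fun i _ => Finset.sum_nonneg fun j _ => Finset.sum_nonneg fun k _ =>
      sq_nonneg _
  have e : ∀ i j k, ((x i j - h i j) - (x i k - h i k)) ^ 2 = (x i j - x i k) ^ 2
      - 2 * ((h i j - h i k) * (x i j - x i k)) + (h i j - h i k) ^ 2 := fun i j k => by ring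
  simp only [e, Finset.sum_add_distrib, Finset.sum_sub_distrib, ← Finset.mul_sum] at h1
  rw [hh, sum_harmonicExt_mul hx (fun i => rfl), sum_harmonicExt_sq] at h1
  linarith

end Simplex

/-! ### Self-similarity of the energy -/

section Energy

variable {N : ℕ} {p : Fin N → Space N}

open Classical in
theorem energyAt_eq_sum_pairs (m : ℕ) (u : gasket p → ℝ) :
    energyAt p m u = (1 / 2) * (((N : ℝ) + 2) / N) ^ m *
      ∑ z ∈ (vertices p m ×ˢ vertices p m).filter (fun z => SameCell p m z.1 z.2 ∧ z.1 ≠ z.2),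
        (u z.1 - u z.2) ^ 2 := by
  rw [energyAt, Finset.sum_filter, Finset.sum_product]
  congr 1
  refine Finset.sum_congr rfl fun x _ => Finset.sum_congr rfl fun y _ => ?_
  rcases eq_or_ne x y with rfl | h
  · simp
  · simp [h]

theorem energyAt_nonneg (m : ℕ) (u : gasket p → ℝ) : 0 ≤ energyAt p m u := by
  rw [energyAt_eq_sum_pairs]
  have : 0 ≤ ((N : ℝ) + 2) / N := by positivity
  exact mul_nonneg (by positivity) (Finset.sum_nonneg fun _ _ => sq_nonneg _)

theorem energyAt_zero (hp : ∀ i j, i ≠ j → dist (p i) (p j) = 1) (u : gasket p → ℝ) :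
    energyAt p 0 u = 1 / 2 * ∑ i, ∑ j, (u (bdry p i) - u (bdry p j)) ^ 2 := by
  classical
  simp only [energyAt, vertices_zero, sameCell_zero, if_true, pow_zero, mul_one]
  rw [Finset.sum_image fun i _ j _ h => bdry_injective hp h]
  congr 1
  refine Finset.sum_congr rfl fun i _ => ?_
  rw [Finset.sum_image fun i _ j _ h => bdry_injective hp h]

/-- Two distinct points share at most one first-level cell, because different cells meet in one
point. Hence the off-diagonal pairs split disjointly over the cells; diagonal pairs contribute
nothing and were discarded. -/
theorem energyAt_succ (hN : 2 ≤ N) (hp : ∀ i j, i ≠ j → dist (p i) (p j) = 1) (m : ℕ)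
    (u : gasket p → ℝ) :
    energyAt p (m + 1) u = ((N : ℝ) + 2) / N * ∑ i, energyAt p m (u ∘ cellMap p i) := by
  classical
  simp only [energyAt_eq_sum_pairs, ← Finset.mul_sum]
  rw [pow_succ, ← mul_assoc, ← mul_assoc, mul_comm _ (((N : ℝ) + 2) / N), ← mul_assoc,
    Finset.sum_sigma']
  congr 1
  symm
  refine Finset.sum_nbij (fun z => (cellMap p z.1 z.2.1, cellMap p z.1 z.2.2)) ?_ ?_ ?_ ?_
  · rintro ⟨i, x, y⟩ h
    simp only [Finset.mem_sigma, Finset.mem_univ, true_and, Finset.mem_filter,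
      Finset.mem_product] at h ⊢
    exact ⟨⟨(cellMap_mem_vertices hN hp).2 h.1.1, (cellMap_mem_vertices hN hp).2 h.1.2⟩,
      sameCell_succ_iff.2 ⟨i, x, y, h.2.1, rfl, rfl⟩, fun e => h.2.2 (cellMap_injective i e)⟩
  · rintro ⟨i, x, y⟩ h ⟨j, x', y'⟩ h' e
    simp only [Finset.mem_coe, Finset.mem_sigma, Finset.mem_univ, true_and, Finset.mem_filter,
      Finset.mem_product] at h h'
    obtain ⟨e1, e2⟩ := Prod.ext_iff.1 e
    rcases eq_or_ne i j with rfl | hij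
    · have e1' := cellMap_injective i e1
      have e2' := cellMap_injective i e2
      simp only at e1' e2'
      rw [e1', e2']
    · have a1 := (cellMap_eq_cellMap hN hp hij e1).1
      have a2 := (cellMap_eq_cellMap hN hp hij e2).1
      exact absurd (a1.trans a2.symm) h.2.2
  · rintro ⟨x, y⟩ h
    simp only [Finset.mem_coe, Finset.mem_filter, Finset.mem_product] at h
    obtain ⟨i, x', y', hs, rfl, rfl⟩ := sameCell_succ_iff.1 h.2.1
    refine ⟨⟨i, x', y'⟩, ?_, rfl⟩
    simp only [Finset.mem_coe, Finset.mem_sigma, Finset.mem_univ, true_and, Finset.mem_filter,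
      Finset.mem_product]
    exact ⟨⟨(cellMap_mem_vertices hN hp).1 h.1.1, (cellMap_mem_vertices hN hp).1 h.1.2⟩, hs,
      fun e => h.2.2 (by rw [e])⟩
  · rintro ⟨i, x, y⟩ _
    rfl

/-- From level zero to one this is minimality of the harmonic extension, whose factor `N / (N + 2)`
is undone by the renormalisation; self-similarity lifts it to all levels. -/
theorem energyAt_le_succ (hN : 2 ≤ N) (hp : ∀ i j, i ≠ j → dist (p i) (p j) = 1) (m : ℕ)
    (u : gasket p → ℝ) : energyAt p m u ≤ energyAt p (m + 1) u := by
  have hpos : 0 < (N : ℝ) := by positivity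
  induction m generalizing u with
  | zero =>
    have h := simplex_energy_le (x := fun i j => u (cellMap p i (bdry p j)))
      (fun i j => by rw [cellMap_bdry_comm])
    simp only [cellMap_bdry_self] at h
    rw [energyAt_succ hN hp]
    simp only [energyAt_zero hp, Function.comp_apply, ← Finset.mul_sum]
    rw [div_mul_eq_mul_div, div_le_iff₀ (by positivity)] at h
    rw [div_mul_eq_mul_div ((N : ℝ) + 2), le_div_iff₀ hpos]
    linarith
  | succ m ih =>
    rw [energyAt_succ hN hp, energyAt_succ hN hp (m + 1)]
    gcongr with i
    exact ih _

theorem tendsto_energyAt (hN : 2 ≤ N) (hp : ∀ i j, i ≠ j → dist (p i) (p j) = 1)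
    (u : gasket p → ℝ) :
    Tendsto (fun m => ENNReal.ofReal (energyAt p m u)) atTop (𝓝 (energy p u)) := by
  have hmono : Monotone fun m => ENNReal.ofReal (energyAt p m u) :=
    monotone_nat_of_le_succ fun m => ENNReal.ofReal_le_ofReal (energyAt_le_succ hN hp m u)
  have h := tendsto_atTop_iSup hmono
  rwa [energy, h.liminf_eq]

theorem energy_add_energy_le (hN : 2 ≤ N) (hp : ∀ i j, i ≠ j → dist (p i) (p j) = 1)
    {a b u v : gasket p → ℝ}
    (h : ∀ x y, (a x - a y) ^ 2 + (b x - b y) ^ 2 ≤ (u x - u y) ^ 2 + (v x - v y) ^ 2) :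
    energy p a + energy p b ≤ energy p u + energy p v := by
  refine le_of_tendsto_of_tendsto' ((tendsto_energyAt hN hp a).add (tendsto_energyAt hN hp b))
    ((tendsto_energyAt hN hp u).add (tendsto_energyAt hN hp v)) fun m => ?_
  rw [← ENNReal.ofReal_add (energyAt_nonneg m a) (energyAt_nonneg m b),
    ← ENNReal.ofReal_add (energyAt_nonneg m u) (energyAt_nonneg m v)]
  apply ENNReal.ofReal_le_ofReal
  simp only [energyAt_eq_sum_pairs]
  rw [← mul_add, ← mul_add, ← Finset.sum_add_distrib, ← Finset.sum_add_distrib]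
  have : 0 ≤ ((N : ℝ) + 2) / N := by positivity
  exact mul_le_mul_of_nonneg_left (Finset.sum_le_sum fun z _ => h z.1 z.2) (by positivity)

theorem energy_lt_top_of_bound {u : gasket p → ℝ} {C : ℝ} (h : ∀ m, energyAt p m u ≤ C) :
    energy p u < ∞ := by
  refine lt_of_le_of_lt ?_ (ENNReal.ofReal_lt_top (r := C))
  exact liminf_le_of_le (by isBoundedDefault) fun b hb => by
    obtain ⟨m, hm⟩ := hb.exists
    exact hm.trans (ENNReal.ofReal_le_ofReal (h m))

end Energy

/-! ### Gluing, harmonic functions and harmonic splines -/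

section Harmonic

variable {N : ℕ} {p : Fin N → Space N}

/-- By compactness the gasket is a quotient of `N` disjoint copies of itself, and only the contact
points are identified. -/
theorem exists_glue (hN : 2 ≤ N) (hp : ∀ i j, i ≠ j → dist (p i) (p j) = 1)
    {φ : Fin N → C(gasket p, ℝ)} (hφ : ∀ i j, φ i (bdry p j) = φ j (bdry p i)) :
    ∃ u : C(gasket p, ℝ), ∀ i x, u (cellMap p i x) = φ i x := by
  have : CompactSpace (gasket p) := isCompact_iff_compactSpace.1 (isCompact_gasket hN hp)
  let π : C(Fin N × gasket p, gasket p) :=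
    ⟨fun z => cellMap p z.1 z.2, continuous_prod_of_discrete_left.2 continuous_cellMap⟩
  let g : C(Fin N × gasket p, ℝ) :=
    ⟨fun z => φ z.1 z.2, continuous_prod_of_discrete_left.2 fun i => (φ i).continuous⟩
  have hsurj : Function.Surjective π := fun x => by
    obtain ⟨i, y, h⟩ := exists_cellMap_eq hN hp x
    exact ⟨(i, y), h⟩
  have hq : Topology.IsQuotientMap π :=
    π.continuous.isClosedMap.isQuotientMap π.continuous hsurj
  have hfac : Function.FactorsThrough g π := by
    rintro ⟨i, x⟩ ⟨j, y⟩ h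
    change cellMap p i x = cellMap p j y at h
    change φ i x = φ j y
    rcases eq_or_ne i j with rfl | hij
    · rw [cellMap_injective i h]
    · obtain ⟨rfl, rfl⟩ := cellMap_eq_cellMap hN hp hij h
      exact hφ i j
  refine ⟨hq.lift g hfac, fun i x => ?_⟩
  exact DFunLike.congr_fun (hq.lift_comp g hfac) (i, x)

open Classical in
/-- The function whose pullbacks to the cells of level one are `φ i`, if there is one. -/
def glue (φ : Fin N → C(gasket p, ℝ)) : C(gasket p, ℝ) :=
  if h : ∃ u : C(gasket p, ℝ), ∀ i x, u (cellMap p i x) = φ i x then h.choose else 0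

theorem glue_cellMap (hN : 2 ≤ N) (hp : ∀ i j, i ≠ j → dist (p i) (p j) = 1)
    {φ : Fin N → C(gasket p, ℝ)} (hφ : ∀ i j, φ i (bdry p j) = φ j (bdry p i)) (i : Fin N)
    (x : gasket p) : glue φ (cellMap p i x) = φ i x := by
  have h := exists_glue hN hp hφ
  rw [glue, dif_pos h]
  exact h.choose_spec i x

theorem glue_energyAt_le (hN : 2 ≤ N) (hp : ∀ i j, i ≠ j → dist (p i) (p j) = 1)
    {φ : Fin N → C(gasket p, ℝ)} (hφ : ∀ i j, φ i (bdry p j) = φ j (bdry p i))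
    {C : Fin N → ℝ} (hC : ∀ i m, energyAt p m (φ i) ≤ C i) (m : ℕ) :
    energyAt p m (glue φ) ≤ ((N : ℝ) + 2) / N * ∑ i, C i := by
  -- Raising the level by one makes the cell decomposition available also for `m = 0`.
  refine (energyAt_le_succ hN hp m _).trans ?_
  rw [energyAt_succ hN hp]
  gcongr with i
  have : (glue φ : gasket p → ℝ) ∘ cellMap p i = φ i :=
    funext fun x => glue_cellMap hN hp hφ i x
  rw [this]
  exact hC i m

theorem harmonicExt_mem_Icc {c : Fin N → ℝ} {a b : ℝ} (hc : ∀ i, c i ∈ Icc a b) (i j : Fin N) :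
    harmonicExt c i j ∈ Icc a b := by
  rcases eq_or_ne i j with rfl | hij
  · rw [harmonicExt_self]; exact hc i
  · have h1 : N * a ≤ ∑ k, c k := by
      have := Finset.card_nsmul_le_sum Finset.univ c a fun k _ => (hc k).1
      simpa using this
    have h2 : ∑ k, c k ≤ N * b := by
      have := Finset.sum_le_card_nsmul Finset.univ c b fun k _ => (hc k).2
      simpa using this
    rw [harmonicExt, if_neg hij, mem_Icc, le_div_iff₀ (by positivity), div_le_iff₀ (by positivity)]
    constructor <;> linarith [(hc i).1, (hc i).2, (hc j).1, (hc j).2]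

/-- The worst case compares a midpoint with the vertex `p i`: the numerator has `N + 1` differences,
one of which is zero. -/
theorem abs_harmonicExt_sub_le (hN : 2 ≤ N) {c : Fin N → ℝ} {D : ℝ}
    (hc : ∀ i j, |c i - c j| ≤ D) (i j k : Fin N) :
    |harmonicExt c i j - harmonicExt c i k| ≤ N / (N + 2) * D := by
  have hD : 0 ≤ D := (abs_nonneg _).trans (hc i i)
  have hN1 : (1 : ℝ) ≤ N := by exact_mod_cast (by omega : 1 ≤ N)
  have hpos : (0 : ℝ) < N + 2 := by positivity
  have hself : ∀ j, j ≠ i → |harmonicExt c i j - c i| ≤ N / (N + 2) * D := by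
    intro j hj
    have e : harmonicExt c i j - c i = (c j - c i + ∑ k, (c k - c i)) / (N + 2) := by
      rw [harmonicExt, if_neg hj.symm, Finset.sum_sub_distrib]
      simp only [Finset.sum_const, Finset.card_univ, Fintype.card_fin, nsmul_eq_mul]
      field_simp
      ring
    have h1 : |∑ k, (c k - c i)| ≤ (N - 1) * D := by
      rw [← Finset.add_sum_erase _ _ (Finset.mem_univ i), sub_self, zero_add]
      refine (Finset.abs_sum_le_sum_abs _ _).trans ?_
      refine (Finset.sum_le_card_nsmul _ _ D fun k _ => hc k i).trans_eq ?_
      rw [Finset.card_erase_of_mem (Finset.mem_univ i), Finset.card_univ, Fintype.card_fin,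
        nsmul_eq_mul, Nat.cast_sub (by omega), Nat.cast_one]
    rw [e, abs_div, abs_of_pos hpos, div_mul_eq_mul_div]
    gcongr
    refine (abs_add_le _ _).trans ?_
    linarith [hc j i]
  rcases eq_or_ne j i with rfl | hj
  · rcases eq_or_ne k j with rfl | hk
    · rw [sub_self, abs_zero]; positivity
    · rw [harmonicExt_self, abs_sub_comm]; exact hself k hk
  · rcases eq_or_ne k i with rfl | hk
    · rw [harmonicExt_self]; exact hself j hj
    · have e : harmonicExt c i j - harmonicExt c i k = (c j - c k) / (N + 2) := by
        rw [harmonicExt, harmonicExt, if_neg hj.symm, if_neg hk.symm]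
        ring
      rw [e, abs_div, abs_of_pos hpos, div_mul_eq_mul_div]
      gcongr
      nlinarith [hc j k]

/-- Approximations of the harmonic function with boundary values `c`. -/
def harmonicSeq (p : Fin N → Space N) : ℕ → (Fin N → ℝ) → C(gasket p, ℝ)
  | 0, c => ⟨fun x => ∑ i, bary p i x * c i, continuous_finsetSum _ fun i _ =>
      ((continuous_bary i).comp continuous_subtype_val).mul continuous_const⟩
  | n + 1, c => glue fun i => harmonicSeq p n (harmonicExt c i)

theorem harmonicSeq_bdry (hN : 2 ≤ N) (hp : ∀ i j, i ≠ j → dist (p i) (p j) = 1) (n : ℕ)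
    (c : Fin N → ℝ) (j : Fin N) : harmonicSeq p n c (bdry p j) = c j := by
  induction n generalizing c j with
  | zero => simp [harmonicSeq, bdry, bary_vertex hN hp]
  | succ n ih =>
    rw [harmonicSeq, ← cellMap_bdry_self j, glue_cellMap hN hp, ih, harmonicExt_self]
    intro i j
    rw [ih, ih, harmonicExt_comm]

theorem harmonicSeq_succ_cellMap (hN : 2 ≤ N) (hp : ∀ i j, i ≠ j → dist (p i) (p j) = 1) (n : ℕ)
    (c : Fin N → ℝ) (i : Fin N) (x : gasket p) :
    harmonicSeq p (n + 1) c (cellMap p i x) = harmonicSeq p n (harmonicExt c i) x := by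
  rw [harmonicSeq, glue_cellMap hN hp]
  intro i j
  rw [harmonicSeq_bdry hN hp, harmonicSeq_bdry hN hp, harmonicExt_comm]

theorem harmonicSeq_mem_Icc (hN : 2 ≤ N) (hp : ∀ i j, i ≠ j → dist (p i) (p j) = 1) (n : ℕ)
    {c : Fin N → ℝ} {a b : ℝ} (hc : ∀ i, c i ∈ Icc a b) (x : gasket p) :
    harmonicSeq p n c x ∈ Icc a b := by
  induction n generalizing c x with
  | zero =>
    have := (convex_Icc a b).sum_mem (t := Finset.univ) (w := fun i => bary p i x) (z := c)
      (fun i _ => bary_nonneg hN hp x.2 i) (sum_bary hN _) fun i _ => hc i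
    simpa [harmonicSeq] using! this
  | succ n ih =>
    obtain ⟨i, y, rfl⟩ := exists_cellMap_eq hN hp x
    rw [harmonicSeq_succ_cellMap hN hp]
    exact ih (harmonicExt_mem_Icc hc i) y

/-- The first two approximations stay within `D` of `c 0`, hence within `2 * D` of each other; each
further level contracts the oscillation of the data. -/
theorem abs_harmonicSeq_succ_sub_le (hN : 2 ≤ N) (hp : ∀ i j, i ≠ j → dist (p i) (p j) = 1)
    (n : ℕ) {c : Fin N → ℝ} {D : ℝ} (hc : ∀ i j, |c i - c j| ≤ D) (x : gasket p) :
    |harmonicSeq p n c x - harmonicSeq p (n + 1) c x| ≤ 2 * D * (N / (N + 2) : ℝ) ^ n := by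
  induction n generalizing c D x with
  | zero =>
    have h0 : ∀ i, c i ∈ Icc (c ⟨0, by omega⟩ - D) (c ⟨0, by omega⟩ + D) := fun i => by
      have := abs_le.1 (hc i ⟨0, by omega⟩)
      constructor <;> linarith
    have h1 := harmonicSeq_mem_Icc hN hp 0 h0 x
    have h2 := harmonicSeq_mem_Icc hN hp 1 h0 x
    rw [abs_le, pow_zero]
    constructor <;> linarith [h1.1, h1.2, h2.1, h2.2]
  | succ n ih =>
    obtain ⟨i, y, rfl⟩ := exists_cellMap_eq hN hp x
    rw [harmonicSeq_succ_cellMap hN hp, harmonicSeq_succ_cellMap hN hp]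
    refine (ih (fun j k => abs_harmonicExt_sub_le hN hc i j k) y).trans_eq ?_
    ring

/-- The harmonic functions on the gasket. -/
theorem exists_harmonic (hN : 2 ≤ N) (hp : ∀ i j, i ≠ j → dist (p i) (p j) = 1) :
    ∃ h : (Fin N → ℝ) → C(gasket p, ℝ), (∀ c j, h c (bdry p j) = c j) ∧
      (∀ c i x, h c (cellMap p i x) = h (harmonicExt c i) x) ∧
      ∀ c a b, (∀ i, c i ∈ Icc a b) → ∀ x, h c x ∈ Icc a b := by
  have : CompactSpace (gasket p) := isCompact_iff_compactSpace.1 (isCompact_gasket hN hp)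
  have hlim : ∀ c : Fin N → ℝ, ∃ h : C(gasket p, ℝ),
      Tendsto (fun n => harmonicSeq p n c) atTop (𝓝 h) := by
    intro c
    have hc : ∀ i j, |c i - c j| ≤ ∑ i, ∑ j, |c i - c j| := fun i j =>
      (Finset.single_le_sum (f := fun j => |c i - c j|) (fun _ _ => abs_nonneg _)
        (Finset.mem_univ j)).trans
        (Finset.single_le_sum (f := fun i => ∑ j, |c i - c j|)
          (fun _ _ => Finset.sum_nonneg fun _ _ => abs_nonneg _) (Finset.mem_univ i))
    set D := ∑ i, ∑ j, |c i - c j|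
    have hD : 0 ≤ D := Finset.sum_nonneg fun _ _ => Finset.sum_nonneg fun _ _ => abs_nonneg _
    refine cauchySeq_tendsto_of_complete (cauchySeq_of_le_geometric (N / (N + 2) : ℝ) (2 * D)
      (by rw [div_lt_one (by positivity)]; linarith) fun n => ?_)
    rw [ContinuousMap.dist_le (by positivity)]
    intro x
    rw [Real.dist_eq]
    exact abs_harmonicSeq_succ_sub_le hN hp n hc x
  choose h hh using hlim
  have hpt : ∀ c x, Tendsto (fun n => harmonicSeq p n c x) atTop (𝓝 (h c x)) := fun c x =>
    ((continuous_eval_const x).tendsto (h c)).comp (hh c)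
  refine ⟨h, fun c j => ?_, fun c i x => ?_, fun c a b hc x => ?_⟩
  · refine tendsto_nhds_unique (hpt c _) ?_
    simp only [harmonicSeq_bdry hN hp]
    exact tendsto_const_nhds
  · refine tendsto_nhds_unique ((hpt c _).comp (tendsto_add_atTop_nat 1)) ?_
    refine (hpt (harmonicExt c i) x).congr fun n => ?_
    exact (harmonicSeq_succ_cellMap hN hp n c i x).symm
  · exact isClosed_Icc.mem_of_tendsto (hpt c x)
      (Eventually.of_forall fun n => harmonicSeq_mem_Icc hN hp n hc x)

/-- On each cell the function is again harmonic, so the energy identity for `harmonicExt` makes the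
renormalised energy independent of the level. -/
theorem energyAt_harmonic (hN : 2 ≤ N) (hp : ∀ i j, i ≠ j → dist (p i) (p j) = 1)
    {h : (Fin N → ℝ) → C(gasket p, ℝ)} (h1 : ∀ c j, h c (bdry p j) = c j)
    (h2 : ∀ c i x, h c (cellMap p i x) = h (harmonicExt c i) x) (m : ℕ) (c : Fin N → ℝ) :
    energyAt p m (h c) = 1 / 2 * ∑ i, ∑ j, (c i - c j) ^ 2 := by
  have hpos : (0 : ℝ) < N := by positivity
  induction m generalizing c with
  | zero => simp only [energyAt_zero hp, h1]
  | succ m ih =>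
    have e : ∀ i, (h c : gasket p → ℝ) ∘ cellMap p i = h (harmonicExt c i) := fun i =>
      funext fun x => h2 c i x
    simp only [energyAt_succ hN hp, e, ih]
    rw [← Finset.mul_sum, sum_harmonicExt_sq]
    field_simp

theorem dist_cellMap (i : Fin N) (x y : gasket p) :
    dist (cellMap p i x) (cellMap p i y) = 1 / 2 * dist x y := by
  rw [Subtype.dist_eq, Subtype.dist_eq, dist_eq_norm, dist_eq_norm]
  have : (cellMap p i x : Space N) - cellMap p i y = (1 / 2 : ℝ) • ((x : Space N) - y) := by
    simp only [cellMap, simMap]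
    module
  rw [this, norm_smul, Real.norm_of_nonneg (by norm_num)]

/-- Approximation by functions of finite energy, with the same boundary values. -/
theorem exists_spline (hN : 2 ≤ N) (hp : ∀ i j, i ≠ j → dist (p i) (p j) = 1) {D : ℝ}
    (hD : ∀ x y : gasket p, dist x y ≤ D) {ε : ℝ} (m : ℕ) (f : C(gasket p, ℝ))
    (hf : ∀ x y, dist x y ≤ D / 2 ^ m → |f x - f y| ≤ ε) :
    ∃ u : C(gasket p, ℝ), (∃ C, ∀ k, energyAt p k u ≤ C) ∧
      (∀ j, u (bdry p j) = f (bdry p j)) ∧ ∀ x, |u x - f x| ≤ ε := by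
  induction m generalizing f with
  | zero =>
    obtain ⟨h, h1, h2, h3⟩ := exists_harmonic hN hp
    refine ⟨h fun i => f (bdry p i), ⟨_, fun k => (energyAt_harmonic hN hp h1 h2 k _).le⟩,
      fun j => h1 _ j, fun x => ?_⟩
    -- At level zero all vertex values lie within `ε` of `f x`, and harmonic functions stay within
    -- the range of their data.
    have := h3 (fun i => f (bdry p i)) (f x - ε) (f x + ε) (fun i => by
      have := abs_le.1 (hf (bdry p i) x (by simpa using hD _ _))
      constructor <;> linarith) x
    rw [abs_le]
    constructor <;> linarith [this.1, this.2]
  | succ m ih =>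
    have hstep : ∀ i, ∃ u : C(gasket p, ℝ), (∃ C, ∀ k, energyAt p k u ≤ C) ∧
        (∀ j, u (bdry p j) = f (cellMap p i (bdry p j))) ∧
        ∀ x, |u x - f (cellMap p i x)| ≤ ε := fun i =>
      ih (f.comp ⟨cellMap p i, continuous_cellMap i⟩) fun x y hxy => hf (cellMap p i x) (cellMap p i y) (by
        rw [dist_cellMap, pow_succ, ← div_div]
        linarith)
    choose φ hφ1 hφ2 hφ3 using hstep
    choose C hC using hφ1
    have hcomp : ∀ i j, φ i (bdry p j) = φ j (bdry p i) := fun i j => by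
      rw [hφ2, hφ2, cellMap_bdry_comm]
    refine ⟨glue φ, ⟨_, glue_energyAt_le hN hp hcomp hC⟩, fun j => ?_, fun x => ?_⟩
    · rw [← cellMap_bdry_self j, glue_cellMap hN hp hcomp, hφ2]
    · obtain ⟨i, y, rfl⟩ := exists_cellMap_eq hN hp x
      rw [glue_cellMap hN hp hcomp]
      exact hφ3 i y

theorem exists_sobolev_near (hN : 2 ≤ N) (hp : ∀ i j, i ≠ j → dist (p i) (p j) = 1)
    (f : C(gasket p, ℝ)) {ε : ℝ} (hε : 0 < ε) :
    ∃ u ∈ sobolev p, (∀ j, u (bdry p j) = f (bdry p j)) ∧ ∀ x, |u x - f x| ≤ ε := by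
  have : CompactSpace (gasket p) := isCompact_iff_compactSpace.1 (isCompact_gasket hN hp)
  obtain ⟨δ, hδ, hf⟩ := Metric.uniformContinuous_iff.1
    (CompactSpace.uniformContinuous_of_continuous f.continuous) ε hε
  have hD : ∀ x y : gasket p, dist x y ≤ Metric.diam (univ : Set (gasket p)) := fun x y =>
    Metric.dist_le_diam_of_mem isCompact_univ.isBounded (mem_univ x) (mem_univ y)
  have hlim : Tendsto (fun m : ℕ => Metric.diam (univ : Set (gasket p)) / 2 ^ m) atTop (𝓝 0) :=
    tendsto_const_nhds.div_atTop (tendsto_pow_atTop_atTop_of_one_lt one_lt_two)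
  obtain ⟨m, hm⟩ := (hlim.eventually (gt_mem_nhds hδ)).exists
  obtain ⟨u, ⟨C, hC⟩, hu1, hu2⟩ := exists_spline hN hp hD m f
    fun x y hxy => (hf (hxy.trans_lt hm)).le
  exact ⟨u, energy_lt_top_of_bound hC, hu1, hu2⟩

end Harmonic

/-! ### The perturbed energy -/

section Perturbed

variable {N : ℕ} {p : Fin N → Space N} {μ : Measure (gasket p)} {B : Fin N → ℝ → ℝ≥0∞}

theorem perturbedEnergy_le {f : Lp ℝ 2 μ} {u : C(gasket p, ℝ)} (hu : u ∈ sobolev p)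
    (huf : (u : gasket p → ℝ) =ᵐ[μ] f) :
    perturbedEnergy p μ B f ≤ energy p u + ∑ i, B i (u (bdry p i)) :=
  iInf₂_le u ⟨hu, huf⟩

theorem exists_representative [μ.IsOpenPosMeasure] {f : Lp ℝ 2 μ}
    (hf : perturbedEnergy p μ B f < ∞) :
    ∃ u ∈ sobolev p, (u : gasket p → ℝ) =ᵐ[μ] f ∧
      perturbedEnergy p μ B f = energy p u + ∑ i, B i (u (bdry p i)) := by
  obtain ⟨u, hu⟩ := iInf_lt_iff.1 hf
  obtain ⟨⟨h1, h2⟩, -⟩ := iInf_lt_iff.1 hu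
  refine ⟨u, h1, h2, le_antisymm (perturbedEnergy_le h1 h2) (le_iInf₂ fun v hv => ?_)⟩
  have : u = v := DFunLike.coe_injective
    ((Continuous.ae_eq_iff_eq μ u.continuous v.continuous).1 (h2.trans hv.2.symm))
  rw [this]

theorem nonneg_of_ae_eq [μ.IsOpenPosMeasure] {g : Lp ℝ 2 μ} (hg : 0 ≤ g) {v : C(gasket p, ℝ)}
    (hv : (v : gasket p → ℝ) =ᵐ[μ] g) (x : gasket p) : 0 ≤ v x := by
  have h : (fun x => max (v x) 0) =ᵐ[μ] v := by
    filter_upwards [hv, (Lp.coeFn_nonneg g).2 hg] with x h1 h2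
    rw [max_eq_left]
    rw [h1]
    exact h2
  have := (Continuous.ae_eq_iff_eq μ (by fun_prop) v.continuous).1 h
  rw [← congrFun this x]
  exact le_max_right _ _

theorem energy_zero : energy p (0 : C(gasket p, ℝ)) = 0 := by
  simp [energy, energyAt]

theorem perturbedEnergy_zero (hB : ∀ i, B i 0 = 0) : perturbedEnergy p μ B 0 = 0 := by
  have h0 : (0 : C(gasket p, ℝ)) ∈ sobolev p := by
    change energy p _ < ∞
    rw [energy_zero]
    exact ENNReal.zero_lt_top
  have h := perturbedEnergy_le (B := B) (μ := μ) h0 (Lp.coeFn_zero ℝ 2 μ).symm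
  rw [energy_zero] at h
  simpa [hB] using h

theorem energy_neg (u : C(gasket p, ℝ)) : energy p (-u : C(gasket p, ℝ)) = energy p u := by
  have e : ∀ x y, (-u x - -u y) ^ 2 = (u x - u y) ^ 2 := fun x y => by ring
  simp only [energy, energyAt, ContinuousMap.coe_neg, Pi.neg_apply, e]

theorem perturbedEnergy_neg_le (f : Lp ℝ 2 μ) :
    perturbedEnergy p μ (fun i s => B i (-s)) (-f) ≤ perturbedEnergy p μ B f := by
  refine le_iInf₂ fun u hu => ?_
  have h1 : -u ∈ sobolev p := by
    change energy p _ < ∞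
    rw [energy_neg]
    exact hu.1
  have h2 : ((-u : C(gasket p, ℝ)) : gasket p → ℝ) =ᵐ[μ] (-f : Lp ℝ 2 μ) :=
    hu.2.neg.trans (Lp.coeFn_neg f).symm
  refine (perturbedEnergy_le h1 h2).trans_eq ?_
  rw [energy_neg]
  simp

theorem perturbedEnergy_neg (f : Lp ℝ 2 μ) :
    perturbedEnergy p μ (fun i s => B i (-s)) f = perturbedEnergy p μ B (-f) := by
  apply le_antisymm
  · simpa using perturbedEnergy_neg_le (B := B) (-f)
  · simpa using perturbedEnergy_neg_le (B := fun i s => B i (-s)) f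

/-! ### Density of the effective domain -/

section Density

variable [IsFiniteMeasure μ]

/-- The approximations keep the zero boundary values, so the boundary terms vanish even where `B i`
is infinite away from `0`. -/
theorem toLp_mem_closure_of_vanishing (hN : 2 ≤ N) (hp : ∀ i j, i ≠ j → dist (p i) (p j) = 1)
    [CompactSpace (gasket p)] (hB : ∀ i, B i 0 = 0) {f : C(gasket p, ℝ)}
    (hf : ∀ j, f (bdry p j) = 0) :
    ContinuousMap.toLp 2 μ ℝ f ∈ closure (effDomain (perturbedEnergy p μ B)) := by
  choose u hu1 hu2 hu3 using fun n : ℕ =>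
    exists_sobolev_near hN hp f (show 0 < 1 / ((n : ℝ) + 1) by positivity)
  have hlim : Tendsto u atTop (𝓝 f) := by
    rw [tendsto_iff_dist_tendsto_zero]
    refine squeeze_zero (fun _ => dist_nonneg) (fun n => ?_)
      tendsto_one_div_add_atTop_nhds_zero_nat
    rw [ContinuousMap.dist_le (by positivity)]
    intro x
    rw [Real.dist_eq]
    exact hu3 n x
  refine mem_closure_of_tendsto
    (((ContinuousMap.toLp 2 μ ℝ).continuous.tendsto f).comp hlim) (Eventually.of_forall fun n => ?_)
  change perturbedEnergy p μ B _ < ∞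
  refine (perturbedEnergy_le (hu1 n) (ContinuousMap.coeFn_toLp (𝕜 := ℝ) μ (u n)).symm).trans_lt ?_
  simp only [hu2, hf, hB, Finset.sum_const_zero, add_zero]
  exact hu1 n

theorem tendsto_toLp_of_bounded [CompactSpace (gasket p)] {f : C(gasket p, ℝ)}
    {F : ℕ → C(gasket p, ℝ)} {C : ℝ} (hb : ∀ n x, |F n x - f x| ≤ C)
    (hlim : ∀ᵐ x ∂μ, Tendsto (fun n => F n x) atTop (𝓝 (f x))) :
    Tendsto (fun n => ContinuousMap.toLp 2 μ ℝ (F n)) atTop (𝓝 (ContinuousMap.toLp 2 μ ℝ f)) := by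
  rw [tendsto_iff_norm_sub_tendsto_zero]
  have hsq : ∀ n, ‖ContinuousMap.toLp 2 μ ℝ (F n) - ContinuousMap.toLp 2 μ ℝ f‖ ^ 2 =
      ∫ x, (F n x - f x) ^ 2 ∂μ := by
    intro n
    rw [← map_sub, ← real_inner_self_eq_norm_sq, L2.inner_def]
    refine integral_congr_ae ?_
    filter_upwards [ContinuousMap.coeFn_toLp (p := 2) (𝕜 := ℝ) μ (F n - f)] with x hx
    rw [hx]
    simp [sq]
  have h1 : Tendsto (fun n => ∫ x, (F n x - f x) ^ 2 ∂μ) atTop (𝓝 (∫ _, (0 : ℝ) ∂μ)) := by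
    refine tendsto_integral_of_dominated_convergence (fun _ => C ^ 2) (fun n => ?_)
      (integrable_const _) (fun n => Eventually.of_forall fun x => ?_) ?_
    · exact (Continuous.aestronglyMeasurable (by fun_prop))
    · rw [Real.norm_of_nonneg (sq_nonneg _), ← sq_abs]
      have := hb n x
      gcongr
    · filter_upwards [hlim] with x hx
      have := (hx.sub_const (f x)).pow 2
      simpa using this
  simp only [← hsq, integral_zero] at h1
  have h2 := (Real.continuous_sqrt.tendsto 0).comp h1
  simpa [Function.comp_def, Real.sqrt_sq] using h2

theorem dense_effDomain (hN : 2 ≤ N) (hp : ∀ i j, i ≠ j → dist (p i) (p j) = 1)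
    (hμ : μ (range (bdry p)) = 0) (hB : ∀ i, B i 0 = 0) :
    Dense (effDomain (perturbedEnergy p μ B)) := by
  have : CompactSpace (gasket p) := isCompact_iff_compactSpace.1 (isCompact_gasket hN hp)
  rw [← dense_closure]
  refine (ContinuousMap.toLp_denseRange ℝ μ ℝ (p := 2) (by norm_num)).mono ?_
  rintro _ ⟨f, rfl⟩
  have hcl : IsClosed (range (bdry p)) := (finite_range _).isClosed
  have hne : (range (bdry p)).Nonempty := ⟨_, ⟨0, by omega⟩, rfl⟩
  -- Cut-offs that vanish on `V₀` and tend to one off this null set; dominated convergence turns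
  -- this into `L²` convergence.
  set χ : ℕ → C(gasket p, ℝ) := fun n =>
    ⟨fun x => min 1 (n * Metric.infDist x (range (bdry p))), by fun_prop⟩ with hχ
  have hχ0 : ∀ n x, 0 ≤ χ n x := fun n x =>
    le_min zero_le_one (mul_nonneg n.cast_nonneg Metric.infDist_nonneg)
  have hχ1 : ∀ n x, χ n x ≤ 1 := fun n x => min_le_left _ _
  rw [← closure_closure]
  refine mem_closure_of_tendsto (tendsto_toLp_of_bounded (F := fun n => f * χ n) (C := ‖f‖)
    (fun n x => ?_) ?_) (Eventually.of_forall fun n => ?_)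
  · have e : (f * χ n) x - f x = -(f x * (1 - χ n x)) := by
      rw [ContinuousMap.mul_apply]; ring
    rw [e, abs_neg, abs_mul]
    have h1 : |f x| ≤ ‖f‖ := f.norm_coe_le_norm x
    have h2 : |1 - χ n x| ≤ 1 := by
      rw [abs_le]; constructor <;> linarith [hχ0 n x, hχ1 n x]
    calc _ ≤ ‖f‖ * 1 := mul_le_mul h1 h2 (abs_nonneg _) (norm_nonneg _)
      _ = _ := mul_one _
  · filter_upwards [compl_mem_ae_iff.2 hμ] with x hx
    have hpos : 0 < Metric.infDist x (range (bdry p)) :=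
      (hcl.notMem_iff_infDist_pos hne).1 hx
    refine tendsto_const_nhds.congr' ?_
    obtain ⟨n₀, hn₀⟩ := exists_nat_gt (1 / Metric.infDist x (range (bdry p)))
    filter_upwards [eventually_ge_atTop n₀] with n hn
    have h1 : χ n x = 1 := by
      refine min_eq_left ?_
      rw [div_lt_iff₀ hpos] at hn₀
      have : (n₀ : ℝ) ≤ n := by exact_mod_cast hn
      nlinarith
    rw [ContinuousMap.mul_apply, h1, mul_one]
  · refine toLp_mem_closure_of_vanishing hN hp hB fun j => ?_
    have : χ n (bdry p j) = 0 := by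
      simp [hχ, Metric.infDist_zero_of_mem (mem_range_self (f := bdry p) j)]
    rw [ContinuousMap.mul_apply, this, mul_zero]

end Density

/-! ### Truncation -/

/-- With `d = s - t - k`, the difference of the two sides is `2 Δd⁺ (Δd⁺ - Δd)`, which is
nonpositive because `d ↦ d⁺` is monotone and 1-Lipschitz. -/
theorem truncation_sq_le (k s t s' t' : ℝ) :
    (s - max (s - t - k) 0 - (s' - max (s' - t' - k) 0)) ^ 2
      + (t + max (s - t - k) 0 - (t' + max (s' - t' - k) 0)) ^ 2 ≤
      (s - s') ^ 2 + (t - t') ^ 2 := by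
  have key : ∀ d d' : ℝ, (max d 0 - max d' 0) ^ 2 ≤ (max d 0 - max d' 0) * (d - d') := by
    intro d d'
    rcases le_total d 0 with h | h <;> rcases le_total d' 0 with h' | h' <;>
      simp only [max_eq_left, max_eq_right, h, h'] <;> nlinarith
  nlinarith [key (s - t - k) (s' - t' - k)]

/-- Truncation decreases the sum of two perturbed energies if it does so at the boundary. -/
theorem perturbedEnergy_truncation_le [IsFiniteMeasure μ] [μ.IsOpenPosMeasure] (hN : 2 ≤ N)
    (hp : ∀ i j, i ≠ j → dist (p i) (p j) = 1) {B₁ B₂ : Fin N → ℝ → ℝ≥0∞} (k : ℝ)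
    {f g : Lp ℝ 2 μ}
    (hB : ∀ u v : C(gasket p, ℝ), (u : gasket p → ℝ) =ᵐ[μ] f → (v : gasket p → ℝ) =ᵐ[μ] g → ∀ i,
      B₁ i (u (bdry p i) - max (u (bdry p i) - v (bdry p i) - k) 0)
        + B₂ i (v (bdry p i) + max (u (bdry p i) - v (bdry p i) - k) 0) ≤
      B₁ i (u (bdry p i)) + B₂ i (v (bdry p i))) :
    perturbedEnergy p μ B₁ (f - ((f - g - Lp.const 2 μ k) ⊔ 0))
      + perturbedEnergy p μ B₂ (g + ((f - g - Lp.const 2 μ k) ⊔ 0)) ≤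
      perturbedEnergy p μ B₁ f + perturbedEnergy p μ B₂ g := by
  rcases eq_or_ne (perturbedEnergy p μ B₁ f) ∞ with hf | hf
  · rw [hf, top_add]; exact le_top
  rcases eq_or_ne (perturbedEnergy p μ B₂ g) ∞ with hg | hg
  · rw [hg, add_top]; exact le_top
  obtain ⟨u, hu, huf, hWu⟩ := exists_representative hf.lt_top
  obtain ⟨v, hv, hvg, hWv⟩ := exists_representative hg.lt_top
  set w : C(gasket p, ℝ) := ⟨fun x => max (u x - v x - k) 0, by fun_prop⟩ with hw
  have hwae : (w : gasket p → ℝ) =ᵐ[μ] ((f - g - Lp.const 2 μ k) ⊔ 0 : Lp ℝ 2 μ) := by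
    filter_upwards [huf, hvg, Lp.coeFn_sup (f - g - Lp.const 2 μ k) 0,
      Lp.coeFn_sub (f - g) (Lp.const 2 μ k), Lp.coeFn_sub f g, Lp.coeFn_const 2 μ k,
      Lp.coeFn_zero ℝ 2 μ] with x h1 h2 h3 h4 h5 h6 h7
    rw [h3, Pi.sup_apply, h4, Pi.sub_apply, h5, Pi.sub_apply, h6, h7, ← h1, ← h2]
    rfl
  have hE : energy p (u - w : C(gasket p, ℝ)) + energy p (v + w : C(gasket p, ℝ)) ≤
      energy p u + energy p v :=
    energy_add_energy_le hN hp fun x y => truncation_sq_le k (u x) (v x) (u y) (v y)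
  have hfin : energy p u + energy p v < ∞ := ENNReal.add_lt_top.2 ⟨hu, hv⟩
  obtain ⟨h1, h2⟩ := ENNReal.add_lt_top.1 (hE.trans_lt hfin)
  have e1 := perturbedEnergy_le (B := B₁) (f := f - ((f - g - Lp.const 2 μ k) ⊔ 0)) (u := u - w) h1
    ((huf.sub hwae).trans (Lp.coeFn_sub _ _).symm)
  have e2 := perturbedEnergy_le (B := B₂) (f := g + ((f - g - Lp.const 2 μ k) ⊔ 0)) (u := v + w) h2
    ((hvg.add hwae).trans (Lp.coeFn_add _ _).symm)
  rw [hWu, hWv]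
  refine (add_le_add e1 e2).trans ?_
  rw [add_add_add_comm, add_add_add_comm (energy p u), ← Finset.sum_add_distrib,
    ← Finset.sum_add_distrib]
  exact add_le_add hE (Finset.sum_le_sum fun i _ => hB u v huf hvg i)

end Perturbed

end Gasket

/-! ### Boundary conditions -/

/-- The convention `∞ - ∞ = ∞` matters here: for finite `a'` the right side is below `⊤`, which
rules out `a = ∞`. -/
theorem extSub_le_extSub {a b a' b' : ℝ≥0∞} (h : extSub a b ≤ extSub a' b') :
    a + b' ≤ a' + b := by
  rcases eq_or_ne a' ∞ with rfl | ha'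
  · simp
  rcases eq_or_ne b ∞ with rfl | hb
  · simp
  rw [extSub, extSub, if_neg ha'] at h
  have key : ∀ c d : ℝ≥0∞, c ≠ ∞ → d ≠ ∞ →
      (c : EReal) - (d : EReal) = ((c.toReal - d.toReal : ℝ) : EReal) := by
    intro c d hc hd
    rw [EReal.coe_sub, EReal.coe_ennreal_toReal hc, EReal.coe_ennreal_toReal hd]
  have hlt : ∀ c : ℝ≥0∞, (a' : EReal) - (c : EReal) < ⊤ := by
    intro c
    rcases eq_or_ne c ∞ with rfl | hc
    · simp
    · rw [key a' c ha' hc]; exact EReal.coe_lt_top _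
  split_ifs at h with ha
  · exact absurd (hlt b') (not_lt.2 h)
  rw [key a b ha hb] at h
  rcases eq_or_ne b' ∞ with rfl | hb'
  · rw [EReal.coe_ennreal_top, EReal.sub_top] at h
    exact absurd (EReal.bot_lt_coe _) (not_lt.2 h)
  rw [key a' b' ha' hb', EReal.coe_le_coe_iff] at h
  rw [← ENNReal.toReal_le_toReal (ENNReal.add_ne_top.2 ⟨ha, hb'⟩) (ENNReal.add_ne_top.2 ⟨ha', hb⟩),
    ENNReal.toReal_add ha hb', ENNReal.toReal_add ha' hb]
  linarith

/-- When `s - t > k`, the new points `t + k` and `s - k` are convex combinations of `s` and `t` with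
interchanged weights, so the convexity bounds sum to `β s + β t`. -/
theorem ConvexEnergy.truncation_le {β : ℝ → ℝ≥0∞} (hβ : ConvexEnergy β) {k : ℝ} (hk : 0 ≤ k)
    (s t : ℝ) : β (s - max (s - t - k) 0) + β (t + max (s - t - k) 0) ≤ β s + β t := by
  rcases le_or_gt (s - t - k) 0 with h | h
  · rw [max_eq_right h, sub_zero, add_zero]
  · have hst : 0 < s - t := by linarith
    rw [max_eq_left h.le]
    have ha : 0 ≤ k / (s - t) := by positivity
    have hb : 0 ≤ 1 - k / (s - t) := by rw [sub_nonneg, div_le_one hst]; linarith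
    have h1 := hβ s t _ _ ha hb (by ring)
    have h2 := hβ s t _ _ hb ha (by ring)
    have e1 : (k / (s - t)) • s + (1 - k / (s - t)) • t = s - (s - t - k) := by
      simp only [smul_eq_mul]; field_simp; ring
    have e2 : (1 - k / (s - t)) • s + (k / (s - t)) • t = t + (s - t - k) := by
      simp only [smul_eq_mul]; field_simp; ring
    rw [e1] at h1
    rw [e2] at h2
    refine (add_le_add h1 h2).trans_eq ?_
    have e3 : ENNReal.ofReal (k / (s - t)) + ENNReal.ofReal (1 - k / (s - t)) = 1 := by
      rw [← ENNReal.ofReal_add ha hb, add_sub_cancel, ENNReal.ofReal_one]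
    rw [add_add_add_comm, ← add_mul, add_comm (_ * β t), ← add_mul, e3, one_mul, one_mul]

namespace ConvexFlow

section Const

variable {X : Type*} [MeasurableSpace X] {μ : Measure X} [IsFiniteMeasure μ]

theorem le_const_of_eLpNorm_top {f : Lp ℝ 2 μ} (hf : eLpNorm f ∞ μ ≠ ∞) :
    f ≤ Lp.const 2 μ (eLpNorm f ∞ μ).toReal := by
  rw [← Lp.coeFn_le]
  filter_upwards [Lp.coeFn_const 2 μ (eLpNorm f ∞ μ).toReal,
    ae_le_eLpNormEssSup (f := f) (μ := μ)] with x h1 h2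
  rw [h1, Function.const_apply, eLpNorm_exponent_top]
  rw [eLpNorm_exponent_top] at hf
  have h3 := ENNReal.toReal_mono hf h2
  rw [toReal_enorm] at h3
  exact (le_abs_self _).trans h3

theorem eLpNorm_top_le_of_abs_le {f : Lp ℝ 2 μ} {k : ℝ} (h1 : f ≤ Lp.const 2 μ k)
    (h2 : -f ≤ Lp.const 2 μ k) : eLpNorm f ∞ μ ≤ ENNReal.ofReal k := by
  rw [eLpNorm_exponent_top]
  apply eLpNormEssSup_le_of_ae_bound
  rw [← Lp.coeFn_le] at h1 h2
  filter_upwards [h1, h2, Lp.coeFn_const 2 μ k, Lp.coeFn_neg f] with x h1 h2 h3 h4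
  rw [h3, Function.const_apply] at h1 h2
  rw [h4, Pi.neg_apply] at h2
  exact abs_le'.2 ⟨h1, h2⟩

end Const

/-! ### Reflected flows and the zero flow -/

section Symmetry

variable {H : Type*} [NormedAddCommGroup H] [InnerProductSpace ℝ H] {W : H → ℝ≥0∞}

theorem isGradientFlow_neg {u₀ : H} {u : ℝ≥0 → H} (h : IsGradientFlow W u₀ u) :
    IsGradientFlow (fun f => W (-f)) (-u₀) (fun t => -u t) := by
  obtain ⟨h1, h2, g, h3, h4, h5⟩ := h
  refine ⟨h1.neg, congrArg Neg.neg h2, fun t => -g t, fun a b ha hab => (h3 a b ha hab).neg,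
    fun a b ha hab => ?_, ?_⟩
  · rw [intervalIntegral.integral_neg, ← h4 a b ha hab]
    exact neg_sub_neg _ _ |>.trans (neg_sub _ _).symm
  · filter_upwards [h5] with t ht
    rw [mem_subgradient_iff] at ht ⊢
    simp only [neg_neg]
    refine ⟨ht.1, fun v hv => ?_⟩
    have := ht.2 (-v) hv
    rwa [← neg_add', inner_neg_neg, ← sub_neg_eq_add v] at this

theorem isGradientFlow_zero (hW : W 0 = 0) : IsGradientFlow W 0 fun _ => 0 := by
  refine ⟨continuous_const, rfl, fun _ => 0, fun _ _ _ _ => MemLp.zero, fun _ _ _ _ => by simp,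
    Eventually.of_forall fun t => mem_subgradient_iff.2 ⟨by simp [hW], fun v _ => by simp [hW]⟩⟩

end Symmetry

end ConvexFlow

namespace Gasket

open ConvexFlow

/-! ### Comparison for the perturbed energies -/

section Flow

variable {N : ℕ} {p : Fin N → Space N} {μ : Measure (gasket p)} [IsFiniteMeasure μ]
  [μ.IsOpenPosMeasure]

/-- Truncation at `k = 0` exchanges the boundary values when `u > v`. Since `v ≥ 0`, also at `p_i`
for its continuous representative, the exchange inequality is needed only for nonnegative values. -/
theorem flow_le_flow_of_boundary (hN : 2 ≤ N) (hp : ∀ i j, i ≠ j → dist (p i) (p j) = 1)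
    {B₁ B₂ : Fin N → ℝ → ℝ≥0∞} {u₀ v₀ : Lp ℝ 2 μ} {u v : ℝ≥0 → Lp ℝ 2 μ}
    (hu : IsGradientFlow (perturbedEnergy p μ B₁) u₀ u)
    (hv : IsGradientFlow (perturbedEnergy p μ B₂) v₀ v) (hv0 : ∀ t, 0 ≤ v t)
    (hB : ∀ i s t, 0 ≤ t → t ≤ s → B₁ i t + B₂ i s ≤ B₁ i s + B₂ i t) (h0 : u₀ ≤ v₀) (t : ℝ≥0) :
    u t ≤ v t := by
  have key := sub_le_of_isGradientFlow hu hv (k := Lp.const 2 μ 0) (fun t => ?_)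
    (by rw [map_zero]; exact sub_nonpos.2 h0) t
  · rw [map_zero] at key
    exact sub_nonpos.1 key
  · refine perturbedEnergy_truncation_le hN hp 0 fun f g _ hg i => ?_
    have hg0 := nonneg_of_ae_eq (hv0 t) hg (bdry p i)
    rw [sub_zero]
    rcases le_total (f (bdry p i)) (g (bdry p i)) with h | h
    · rw [max_eq_right (sub_nonpos.2 h), sub_zero, add_zero]
    · rw [max_eq_left (sub_nonneg.2 h), sub_sub_cancel, add_sub_cancel]
      exact hB i _ _ hg0 h

/-- For equal `B` an exchange of boundary values leaves the boundary sum unchanged. Uniqueness,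
order preservation and positivity all come from here. -/
theorem flow_le_flow (hN : 2 ≤ N) (hp : ∀ i j, i ≠ j → dist (p i) (p j) = 1)
    {B : Fin N → ℝ → ℝ≥0∞} {u₀ v₀ : Lp ℝ 2 μ} {u v : ℝ≥0 → Lp ℝ 2 μ}
    (hu : IsGradientFlow (perturbedEnergy p μ B) u₀ u)
    (hv : IsGradientFlow (perturbedEnergy p μ B) v₀ v) (h0 : u₀ ≤ v₀) (t : ℝ≥0) :
    u t ≤ v t := by
  have key := sub_le_of_isGradientFlow hu hv (k := Lp.const 2 μ 0) (fun t => ?_)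
    (by rw [map_zero]; exact sub_nonpos.2 h0) t
  · rw [map_zero] at key
    exact sub_nonpos.1 key
  · refine perturbedEnergy_truncation_le hN hp 0 fun f g _ _ i => ?_
    rw [sub_zero]
    rcases le_total (f (bdry p i)) (g (bdry p i)) with h | h
    · rw [max_eq_right (sub_nonpos.2 h), sub_zero, add_zero]
    · rw [max_eq_left (sub_nonneg.2 h), sub_sub_cancel, add_sub_cancel, add_comm]

theorem flow_sub_flow_le_const (hN : 2 ≤ N) (hp : ∀ i j, i ≠ j → dist (p i) (p j) = 1)
    {B : Fin N → ℝ → ℝ≥0∞} (hB : ∀ i, ConvexEnergy (B i)) {u₀ v₀ : Lp ℝ 2 μ}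
    {u v : ℝ≥0 → Lp ℝ 2 μ} (hu : IsGradientFlow (perturbedEnergy p μ B) u₀ u)
    (hv : IsGradientFlow (perturbedEnergy p μ B) v₀ v) {k : ℝ} (hk : 0 ≤ k)
    (h0 : u₀ - v₀ ≤ Lp.const 2 μ k) (t : ℝ≥0) : u t - v t ≤ Lp.const 2 μ k :=
  sub_le_of_isGradientFlow hu hv (fun _ => perturbedEnergy_truncation_le hN hp k
    fun _ _ _ _ i => (hB i).truncation_le hk _ _) h0 t

/-- Growth on `[0, ∞)` gives `u ≤ v`. The curve `-u` is a flow for the reflected `B'`, and decrease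
on `(-∞, 0]` gives `-u ≤ v`. -/
theorem abs_flow_le_flow (hN : 2 ≤ N) (hp : ∀ i j, i ≠ j → dist (p i) (p j) = 1)
    {B B' : Fin N → ℝ → ℝ≥0∞} {u₀ v₀ : Lp ℝ 2 μ} {u v : ℝ≥0 → Lp ℝ 2 μ}
    (hu : IsGradientFlow (perturbedEnergy p μ B') u₀ u)
    (hv : IsGradientFlow (perturbedEnergy p μ B) v₀ v) (hv0 : ∀ t, 0 ≤ v t)
    (hD : ∀ i, IsBimonotone fun s => extSub (B' i s) (B i |s|)) (h0 : |u₀| ≤ v₀) (t : ℝ≥0) :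
    |u t| ≤ v t := by
  refine abs_le'.2 ⟨?_, ?_⟩
  · refine flow_le_flow_of_boundary hN hp hu hv hv0 (fun i s t ht hts => extSub_le_extSub ?_)
      ((le_abs_self _).trans h0) t
    have := (hD i).2 (mem_Ici.2 ht) (mem_Ici.2 (ht.trans hts)) hts
    simpa only [abs_of_nonneg ht, abs_of_nonneg (ht.trans hts)] using this
  · have hneg := isGradientFlow_neg hu
    simp only [← perturbedEnergy_neg] at hneg
    refine flow_le_flow_of_boundary hN hp hneg hv hv0 (fun i s t ht hts => extSub_le_extSub ?_)
      ((neg_le_abs _).trans h0) t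
    have := (hD i).1 (mem_Iic.2 (neg_nonpos.2 (ht.trans hts))) (mem_Iic.2 (neg_nonpos.2 ht))
      (neg_le_neg hts)
    simpa only [abs_neg, abs_of_nonneg ht, abs_of_nonneg (ht.trans hts)] using this

end Flow

end Gasket

end

theorem theorem3p2 (N : ℕ) (hN : 2 ≤ N)
    (p : Fin N → Gasket.Space N) (hp : ∀ i j, i ≠ j → dist (p i) (p j) = 1)
    (μ : Measure (Gasket.gasket p)) [IsFiniteMeasure μ] [μ.IsOpenPosMeasure]
    (hμ : μ (Set.range (Gasket.bdry p)) = 0)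
    (B : Fin N → ℝ → ℝ≥0∞) (hB : ∀ i, B i 0 = 0)
    (hlsc : LowerSemicontinuous (Gasket.perturbedEnergy p μ B))
    (hconv : ConvexEnergy (Gasket.perturbedEnergy p μ B)) :
    -- the semigroup generated by `W_B` exists, is unique, and lives on all of `L²_μ(V)`
    Dense (effDomain (Gasket.perturbedEnergy p μ B)) ∧
    (∃! S : ℝ≥0 → Lp ℝ 2 μ → Lp ℝ 2 μ, IsGeneratedBy (Gasket.perturbedEnergy p μ B) S) ∧
    ∀ S : ℝ≥0 → Lp ℝ 2 μ → Lp ℝ 2 μ, IsGeneratedBy (Gasket.perturbedEnergy p μ B) S →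
      (IsPositiveSG S ∧ IsOrderPreserving S) ∧
      ((∀ i, ConvexEnergy (B i)) → IsLinftyContractive S) ∧
      ∀ B' : Fin N → ℝ → ℝ≥0∞, (∀ i, B' i 0 = 0) →
        LowerSemicontinuous (Gasket.perturbedEnergy p μ B') →
        ConvexEnergy (Gasket.perturbedEnergy p μ B') →
        ∀ S' : ℝ≥0 → Lp ℝ 2 μ → Lp ℝ 2 μ, IsGeneratedBy (Gasket.perturbedEnergy p μ B') S' →
          ((∀ i, IsBimonotone fun s => extSub (B' i s) (B i |s|)) → IsDominatedBy S' S) ∧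
          ((∀ i, IsBimonotone fun s => extSub (B' i s) (B i |s|)) →
            (∀ i, IsBimonotone fun s => extSub (B' i s) (B i (-|s|))) →
              IsTotallyDominatedBy S' S) := by
  have hdense := Gasket.dense_effDomain (μ := μ) hN hp hμ hB
  refine ⟨hdense, ?_, ?_⟩
  · choose S hS using fun x : Lp ℝ 2 μ => ConvexFlow.exists_isGradientFlow hconv hlsc (hdense x)
    refine ⟨fun t x => S x t, fun x _ => hS x, fun T hT => ?_⟩
    funext t x
    have h := hT x (hdense x)
    -- Uniqueness is comparison in both directions from equal initial values.
    exact le_antisymm (Gasket.flow_le_flow hN hp h (hS x) le_rfl t)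
      (Gasket.flow_le_flow hN hp (hS x) h le_rfl t)
  · intro S hS
    have hflow : ∀ x, IsGradientFlow (Gasket.perturbedEnergy p μ B) x fun t => S t x :=
      fun x => hS x (hdense x)
    have hzero : IsGradientFlow (Gasket.perturbedEnergy p μ B) 0 fun _ => 0 :=
      ConvexFlow.isGradientFlow_zero (Gasket.perturbedEnergy_zero hB)
    have hpos : IsPositiveSG S := fun t u hu => Gasket.flow_le_flow hN hp hzero (hflow u) hu t
    have hord : IsOrderPreserving S := fun t u v huv =>
      Gasket.flow_le_flow hN hp (hflow u) (hflow v) huv t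
    refine ⟨⟨hpos, hord⟩, fun hBc t u v => ?_, fun B' hB' _ _ S' hS' => ?_⟩
    · rcases eq_or_ne (eLpNorm (u - v : Lp ℝ 2 μ) ∞ μ) ∞ with htop | htop
      · rw [htop]; exact le_top
      have hk : 0 ≤ (eLpNorm (u - v : Lp ℝ 2 μ) ∞ μ).toReal := ENNReal.toReal_nonneg
      have hswap : eLpNorm (v - u : Lp ℝ 2 μ) ∞ μ = eLpNorm (u - v : Lp ℝ 2 μ) ∞ μ := by
        rw [← neg_sub u v, eLpNorm_congr_ae (Lp.coeFn_neg _), eLpNorm_neg]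
      have h1 := Gasket.flow_sub_flow_le_const hN hp hBc (hflow u) (hflow v) hk
        (ConvexFlow.le_const_of_eLpNorm_top htop) t
      have h2 := Gasket.flow_sub_flow_le_const hN hp hBc (hflow v) (hflow u) hk
        (by rw [← hswap] at htop ⊢; exact ConvexFlow.le_const_of_eLpNorm_top htop) t
      have h3 := ConvexFlow.eLpNorm_top_le_of_abs_le h1 (by rwa [neg_sub])
      rwa [ENNReal.ofReal_toReal htop] at h3
    · have hdense' := Gasket.dense_effDomain (μ := μ) hN hp hμ hB'
      have hflow' : ∀ x, IsGradientFlow (Gasket.perturbedEnergy p μ B') x fun t => S' t x :=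
        fun x => hS' x (hdense' x)
      have hdom : (∀ i, IsBimonotone fun s => extSub (B' i s) (B i |s|)) → IsDominatedBy S' S :=
        fun hD => ⟨hord, fun t u v huv => Gasket.abs_flow_le_flow hN hp (hflow' u) (hflow v)
          (fun t => hpos t v ((abs_nonneg u).trans huv)) hD huv t⟩
      refine ⟨hdom, fun hD hD' => ⟨hdom hD, fun t u v huv => ?_, fun t u v huv => ?_⟩⟩
      · exact neg_le_neg (hord t _ _ (neg_le_neg huv))
      · have hneg := ConvexFlow.isGradientFlow_neg (hflow (-v))
        rw [neg_neg] at hneg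
        simp only [← Gasket.perturbedEnergy_neg] at hneg
        refine Gasket.abs_flow_le_flow hN hp (hflow' u) hneg (fun t => ?_) hD' huv t
        exact neg_nonneg.2 (Gasket.flow_le_flow hN hp (hflow (-v)) hzero
          (neg_nonpos.2 ((abs_nonneg u).trans huv)) t)
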